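/- Let $\mathbb F_q$ be a finite field of odd order $q$ in which $3$ is a square, let $t\in\mathbb F_q$, $t\neq 0$, and put $S_t=\{x\in\mathbb F_q^2: x_1^2+x_2^2=t\}$; we also write $S_t$ for its indicator function. For functions $f_1,\dots,f_4:\mathbb F_q^2\to[0,\infty)$ define the form of the graph $C_4$ + diagonal $$\diamondsuit_t(f_1,f_2,f_3,f_4)=\frac{1}{q^2|S_t|}\sum_{x^1,x^2,x^3,x^4\in\mathbb F_q^2}S_t(x^1-x^2)S_t(x^2-x^3)S_t(x^3-x^4)S_t(x^4-x^1)S_t(x^1-x^3)\prod_{i=1}^4 f_i(x^i)$$ and the form of the graph $K_3$ + tail (the kite) $$\unlhd(f_1,f_2,f_3,f_4)=\frac{1}{q^2|S_t|^2}\sum_{x^1,x^2,x^3,x^4\in\mathbb F_q^2}S_t(x^1-x^2)S_t(x^2-x^3)S_t(x^3-x^4)S_t(x^3-x^1)\prod_{i=1}^4 f_i(x^i).$$ Let $\|f\|_p=\big(q^{-2}\sum_{x\in\mathbb F_q^2}|f(x)|^p\big)^{1/p}$ for $1\le p<\infty$ and $\|f\|_\infty=\max_{x\in\mathbb F_q^2}|f(x)|$.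 For $1\le p_1,\dots,p_4\le\infty$ (real numbers or $\infty$) let $\diamondsuit_t(p_1,p_2,p_3,p_4)$ and $\unlhd(p_1,p_2,p_3,p_4)$ be the smallest constants $C$ for which, respectively, $\diamondsuit_t(f_1,\dots,f_4)\le C\prod_{i=1}^4\|f_i\|_{p_i}$ and $\unlhd(f_1,\dots,f_4)\le C\prod_{i=1}^4\|f_i\|_{p_i}$ hold for all non-negative real-valued functions $f_1,\dots,f_4$ on $\mathbb F_q^2$. Fix any family of pairs $(\mathbb F_q,t)$ as above (for instance, all such pairs). Write $\lesssim 1$ if the quantity is bounded by a finite constant that is the same for all pairs of the family. Write $\unlhd(p_1,p_2,p_3,p_4)\lessapprox 1$ if there is a constant $C$, the same for all pairs of the family, such that $\unlhd(1_{E_1},1_{E_2},1_{E_3},1_{E_4})\le C\prod_{i=1}^4\|1_{E_i}\|_{p_i}$ for all subsets $E_1,\dots,E_4\subseteq\mathbb F_q^2$. **Theorem.** Let $1\le p_1,p_2,p_3,p_4\le\infty$. If $\diamondsuit_t(p_1,p_2,p_3,p_4)\lesssim 1$ and $(p_1,p_2,p_3,p_4)\ne(2,2,2,\infty)$, then $\unlhd(p_1,p_2,p_3,p_4)\lesssim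 1$. In addition, $\unlhd(2,2,2,\infty)\lessapprox 1$. -/

import Mathlib

open scoped ENNReal NNReal

noncomputable section

namespace GraphForms

/-- The plane `F²` over a field `F`. -/
abbrev Plane (F : Type*) : Type _ := Fin 2 → F

/-- The circle `S_t = {x ∈ F² : x₁² + x₂² = t}`. -/
def circle {F : Type*} [Field F] (t : F) : Set (Plane F) :=
  {x | x 0 ^ 2 + x 1 ^ 2 = t}

/-- The indicator function of the circle `S_t`. -/
def circleInd {F : Type*} [Field F] (t : F) : Plane F → ℝ :=
  (circle t).indicator 1

/-- The `L^p` norm on `F²` with respect to the normalized counting measure: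
`(q⁻² ∑ |f x|^p)^(1/p)` for `p < ∞`, and the maximum of `|f|` for `p = ∞`. -/
def normL {F : Type*} [Fintype F] (p : ℝ≥0∞) (f : Plane F → ℝ) : ℝ :=
  if p = ∞ then ⨆ x, |f x|
  else (((Fintype.card F : ℝ) ^ 2)⁻¹ * ∑ x, |f x| ^ p.toReal) ^ (1 / p.toReal)

/-- The form of the graph `C₄` + diagonal on `F²`: vertices `1, 2, 3, 4`, edges
`12, 23, 34, 41` and the diagonal `13`. In the plane, the normalizing factor is `q² |S_t|`. -/
def diamondForm {F : Type*} [Field F] [Fintype F] (t : F) (f : Fin 4 → Plane F → ℝ) : ℝ :=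
  1 / ((Fintype.card F : ℝ) ^ 2 * ((circle t).ncard : ℝ)) *
    ∑ x₁ : Plane F, ∑ x₂ : Plane F, ∑ x₃ : Plane F, ∑ x₄ : Plane F,
      circleInd t (x₁ - x₂) * circleInd t (x₂ - x₃) * circleInd t (x₃ - x₄) *
        circleInd t (x₄ - x₁) * circleInd t (x₁ - x₃) *
        (f 0 x₁ * f 1 x₂ * f 2 x₃ * f 3 x₄)

/-- The form of the kite (`K₃` + tail) on `F²`: the triangle `123` with the tail `34` attached
at the vertex `3`. In the plane, the normalizing factor is `q² |S_t|²`. -/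
def kiteForm {F : Type*} [Field F] [Fintype F] (t : F) (f : Fin 4 → Plane F → ℝ) : ℝ :=
  1 / ((Fintype.card F : ℝ) ^ 2 * ((circle t).ncard : ℝ) ^ 2) *
    ∑ x₁ : Plane F, ∑ x₂ : Plane F, ∑ x₃ : Plane F, ∑ x₄ : Plane F,
      circleInd t (x₁ - x₂) * circleInd t (x₂ - x₃) * circleInd t (x₃ - x₄) *
        circleInd t (x₃ - x₁) *
        (f 0 x₁ * f 1 x₂ * f 2 x₃ * f 3 x₄)

/-- `Λ(f₁, …, f₄) ≤ C ∏ ‖f_j‖_{p_j}` for all non-negative real-valued functions `f_j` on `F²`. -/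
def StrongBound {F : Type*} [Fintype F] (Λ : (Fin 4 → Plane F → ℝ) → ℝ)
    (p : Fin 4 → ℝ≥0∞) (C : ℝ≥0) : Prop :=
  ∀ f : Fin 4 → Plane F → ℝ, (∀ j x, 0 ≤ f j x) → Λ f ≤ C * ∏ j, normL (p j) (f j)

/-- `Λ(E₁, …, E₄) ≤ C ∏ ‖E_j‖_{p_j}` for all subsets `E_j` of `F²`, which are identified with
their indicator functions. -/
def RestrictedBound {F : Type*} [Fintype F] (Λ : (Fin 4 → Plane F → ℝ) → ℝ)
    (p : Fin 4 → ℝ≥0∞) (C : ℝ≥0) : Prop :=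
  ∀ E : Fin 4 → Set (Plane F),
    Λ (fun j => (E j).indicator 1) ≤ C * ∏ j, normL (p j) ((E j).indicator 1)

/-- The best constant `Λ(p₁, …, p₄)` in the strong-type inequality (`∞` if there is none). -/
def bestConst {F : Type*} [Fintype F] (Λ : (Fin 4 → Plane F → ℝ) → ℝ)
    (p : Fin 4 → ℝ≥0∞) : ℝ≥0∞ :=
  ⨅ (C : ℝ≥0) (_ : StrongBound Λ p C), (C : ℝ≥0∞)

/-- `c ≲ 1`: the quantities `c i` of a family are bounded by one finite constant. -/
def LesssimOne {ι : Type*} (c : ι → ℝ≥0∞) : Prop :=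
  ∃ C : ℝ≥0, 1 ≤ C ∧ ∀ i, c i ≤ C

lemma normL_nonneg {F : Type*} [Fintype F] (p : ℝ≥0∞) (f : Plane F → ℝ) : 0 ≤ normL p f := by
  unfold normL
  split_ifs
  · exact Real.iSup_nonneg fun x => abs_nonneg _
  · positivity

/-- The best constant is attained: it is at most `C` exactly if the inequality holds with `C`. -/
lemma bestConst_le_iff {F : Type*} [Fintype F] (Λ : (Fin 4 → Plane F → ℝ) → ℝ)
    (p : Fin 4 → ℝ≥0∞) (C : ℝ≥0) : bestConst Λ p ≤ C ↔ StrongBound Λ p C := by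
  refine ⟨fun h f hf => ?_, fun h => iInf₂_le C h⟩
  have hP : 0 ≤ ∏ j, normL (p j) (f j) := Finset.prod_nonneg fun j _ => normL_nonneg _ _
  have key : ∀ ε : ℝ, 0 < ε → Λ f ≤ (C + ε) * ∏ j, normL (p j) (f j) := by
    intro ε hε
    have hlt : bestConst Λ p < ((C + ⟨ε, hε.le⟩ : ℝ≥0) : ℝ≥0∞) :=
      h.trans_lt (ENNReal.coe_lt_coe.2 (lt_add_of_pos_right C hε))
    unfold bestConst at hlt
    simp only [iInf_lt_iff] at hlt
    obtain ⟨D, hD, hDC⟩ := hlt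
    have h1 : (D : ℝ) ≤ C + ε := by
      have := (ENNReal.coe_lt_coe.1 hDC).le
      exact_mod_cast this
    exact (hD f hf).trans (mul_le_mul_of_nonneg_right h1 hP)
  refine le_of_forall_pos_le_add fun δ hδ => ?_
  have h2 := key (δ / (1 + ∏ j, normL (p j) (f j))) (by positivity)
  have h3 : δ / (1 + ∏ j, normL (p j) (f j)) * ∏ j, normL (p j) (f j) ≤ δ := by
    rw [div_mul_eq_mul_div, div_le_iff₀ (by positivity)]
    nlinarith
  linarith [add_mul (C : ℝ) (δ / (1 + ∏ j, normL (p j) (f j))) (∏ j, normL (p j) (f j))]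

end GraphForms

end

open scoped ENNReal NNReal

noncomputable section

/-! ### Counting estimates for kernels with few common neighbours. -/

namespace GraphForms

/-! Put a_j = 1/p_j. Testing the diamond on three configurations of equilateral triangles (centred
at x¹, at x³, or at x² = x⁴) shows that boundedness with constant C forces q^β ≤ 16C, where β is the
excess in any of the inequalities 2a₁+a₂+a₃+a₄ ≤ 2, a₁+a₂+2a₃+a₄ ≤ 2, a₁+2a₂+a₃+2a₄ ≤ 2
(`necessary_conditions`). If one of them fails, then β > 0, q is bounded over the family and a
trivial estimate of the kite suffices. Otherwise a lies in a fixed polytope, on which the kite has a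
uniform strong bound.

For that bound, all that is needed of the circle is that its kernel has degrees at most 2q and that
two distinct points have at most two common neighbours (`SparseKernel`). Expanding powers and
counting common neighbours gives two estimates: averaging maps L^(3/2) to L³
(`sum_average_cube_le`), and the triangle operator maps ℓ² × ℓ² to ℓ² (`sum_triangle_sq_le`). They
give the kite bound at the nontrivial vertices of the polytope.

Interpolation is elementary. Every f is dominated by ‖f‖_p g^(1/p) with g ≥ 1 of mean at most 2
(`exists_dominating`), so it is enough to bound the kite of powers F_j^(a_j). This expression is
convex in a, term by term, so the admissible exponents form a convex set (`kiteExponents_convex`);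
it is downward closed because F_j ≥ 1. The polytope depends on a₂ and a₄ only through a₂+a₄, so it
is a mixture of two copies of one three-dimensional polytope (`combination_mem`).

The point (2,2,2,∞) is the vertex (1/2,1/2,1/2,0), where the triangle estimate applies, and the
restricted bound is a special case. -/

/-- A symmetric kernel on a set of `n²` points with degrees at most `2 * n` and with at most two
common neighbours for any two distinct points. -/
structure SparseKernel {V : Type*} [Fintype V] (e : V → V → ℝ) (n : ℝ) : Prop where
  nonneg : ∀ x y, 0 ≤ e x y
  le_one : ∀ x y, e x y ≤ 1
  symm : ∀ x y, e x y = e y x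
  self : ∀ x, e x x = 0
  degree : ∀ x, ∑ y, e x y ≤ 2 * n
  codegree : ∀ x y, x ≠ y → ∑ z, e x z * e y z ≤ 2
  one_le : 1 ≤ n
  card : (Fintype.card V : ℝ) = n ^ 2

/-- The weight of a triangle. -/
def triangle {V : Type*} (e : V → V → ℝ) (x y z : V) : ℝ := e x y * e y z * e z x

namespace SparseKernel

variable {V : Type*} [Fintype V] {e : V → V → ℝ} {n : ℝ}

lemma triangle_nonneg (h : SparseKernel e n) (x y z : V) : 0 ≤ triangle e x y z :=
  mul_nonneg (mul_nonneg (h.nonneg _ _) (h.nonneg _ _)) (h.nonneg _ _)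

lemma triangle_swap (h : SparseKernel e n) (x y z : V) :
    triangle e x y z = triangle e x z y := by
  simp only [triangle, h.symm z x, h.symm y z, h.symm x y]; ring

lemma triangle_rotate {U : Type*} {e : U → U → ℝ} (x y z : U) : triangle e x y z = triangle e y z x := by
  simp only [triangle]; ring

/-- A third vertex is a common neighbour of x and y; the degenerate case x = y is killed by the
vanishing diagonal. -/
lemma sum_triangle_le (h : SparseKernel e n) (x y : V) :
    ∑ z, triangle e x y z ≤ 2 * e x y := by
  have h1 : ∑ z, triangle e x y z = e x y * ∑ z, e y z * e x z := by
    rw [Finset.mul_sum]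
    refine Finset.sum_congr rfl fun z _ => ?_
    rw [triangle, h.symm z x, mul_assoc]
  rw [h1]
  by_cases hxy : y = x
  · subst hxy; simp [h.self]
  · nlinarith [h.codegree y x hxy, h.nonneg x y]

lemma sum_triangle_le_two (h : SparseKernel e n) (x y : V) :
    ∑ z, triangle e x y z ≤ 2 := by
  linarith [h.sum_triangle_le x y, h.le_one x y]

lemma sum_triangle_fst_le_two (h : SparseKernel e n) (x y : V) :
    ∑ z, triangle e z x y ≤ 2 := by
  simp only [triangle_rotate (e := e) _ x y]
  exact h.sum_triangle_le_two x y

/-- Summing over z first leaves the number of common neighbours of x ≠ y. -/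
lemma sum_pair_le (h : SparseKernel e n) (f : V → ℝ) (hf : ∀ x, 0 ≤ f x) [DecidableEq V] :
    ∑ z, ∑ x, ∑ y, e z x * e z y * (if x = y then 0 else f x * f y) ≤ 2 * (∑ x, f x) ^ 2 := by
  rw [Finset.sum_comm]
  have h1 : ∀ x, ∑ z, ∑ y, e z x * e z y * (if x = y then 0 else f x * f y) ≤
      ∑ y, 2 * (f x * f y) := by
    intro x
    rw [Finset.sum_comm]
    refine Finset.sum_le_sum fun y _ => ?_
    rw [← Finset.sum_mul]
    split_ifs with hxy
    · simp; exact mul_nonneg (hf x) (hf y)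
    · refine mul_le_mul_of_nonneg_right ?_ (mul_nonneg (hf x) (hf y))
      simpa only [h.symm _ x, h.symm _ y] using h.codegree x y hxy
  refine (Finset.sum_le_sum fun x _ => h1 x).trans (le_of_eq ?_)
  simp only [← Finset.mul_sum, ← Finset.sum_mul, sq]

/-- The weight does not involve w and s, so each triangle collapses to its edge at z at the cost of
a factor 2. -/
lemma sum_triangle_pair_ne_le (h : SparseKernel e n) (f : V → ℝ) (hf : ∀ x, 0 ≤ f x)
    [DecidableEq V] :
    ∑ z, ∑ x, ∑ w, ∑ y, ∑ s, triangle e z x w * triangle e z y s *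
      (if x = y then 0 else f x * f y) ≤ 8 * (∑ x, f x) ^ 2 := by
  have h1 : ∀ z x, ∑ w, ∑ y, ∑ s, triangle e z x w * triangle e z y s *
      (if x = y then 0 else f x * f y) ≤
        ∑ y, 4 * (e z x * e z y * (if x = y then 0 else f x * f y)) := by
    intro z x
    rw [Finset.sum_comm]
    refine Finset.sum_le_sum fun y _ => ?_
    simp only [← Finset.sum_mul, ← Finset.mul_sum]
    rw [← mul_assoc]
    refine mul_le_mul_of_nonneg_right ?_ ?_
    · calc _ ≤ (2 * e z x) * (2 * e z y) :=
          mul_le_mul (h.sum_triangle_le z x) (h.sum_triangle_le z y)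
            (Finset.sum_nonneg fun s _ => h.triangle_nonneg _ _ _)
            (mul_nonneg zero_le_two (h.nonneg _ _))
        _ = _ := by ring
    · split_ifs
      · exact le_rfl
      · exact mul_nonneg (hf x) (hf y)
  refine (Finset.sum_le_sum fun z _ => Finset.sum_le_sum fun x _ => h1 z x).trans ?_
  simp only [← Finset.mul_sum]
  linarith [h.sum_pair_le f hf]

/-- With x = y fixed, s has at most two positions given the edge zx, and then z has at most two
given x and w. -/
lemma sum_triangle_pair_eq_le (h : SparseKernel e n) (f g : V → ℝ) (hf : ∀ x, 0 ≤ f x)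
    (hg : ∀ x, 0 ≤ g x) [DecidableEq V] :
    ∑ z, ∑ x, ∑ w, ∑ y, ∑ s, triangle e z x w * triangle e z y s *
      (if x = y then f x * g w else 0) ≤ 4 * ((∑ x, f x) * ∑ x, g x) := by
  have h1 : ∀ z x w, ∑ y, ∑ s, triangle e z x w * triangle e z y s *
      (if x = y then f x * g w else 0) ≤ 2 * (triangle e z x w * (f x * g w)) := by
    intro z x w
    have : ∀ y, ∑ s, triangle e z x w * triangle e z y s * (if x = y then f x * g w else 0) =
        if x = y then (∑ s, triangle e z y s) * (triangle e z x w * (f x * g w)) else 0 := by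
      intro y
      split_ifs with hxy
      · rw [Finset.sum_mul]
        exact Finset.sum_congr rfl fun s _ => by ring
      · simp
    simp only [this, Finset.sum_ite_eq, Finset.mem_univ, if_true]
    exact mul_le_mul_of_nonneg_right (h.sum_triangle_le_two z x)
      (mul_nonneg (h.triangle_nonneg _ _ _) (mul_nonneg (hf x) (hg w)))
  refine (Finset.sum_le_sum fun z _ => Finset.sum_le_sum fun x _ =>
    Finset.sum_le_sum fun w _ => h1 z x w).trans ?_
  rw [Finset.sum_comm]
  have h2 : ∀ x, ∑ z, ∑ w, 2 * (triangle e z x w * (f x * g w)) ≤ ∑ w, 4 * (f x * g w) := by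
    intro x
    rw [Finset.sum_comm]
    refine Finset.sum_le_sum fun w _ => ?_
    rw [← Finset.mul_sum, ← Finset.sum_mul]
    nlinarith [h.sum_triangle_fst_le_two x w, mul_nonneg (hf x) (hg w)]
  refine (Finset.sum_le_sum fun x _ => h2 x).trans (le_of_eq ?_)
  simp only [← Finset.mul_sum, ← Finset.sum_mul]

lemma sum_swap_pairs (φ : V → V → V → V → V → ℝ) :
    ∑ z, ∑ x, ∑ w, ∑ y, ∑ s, φ z x w y s = ∑ z, ∑ x, ∑ w, ∑ y, ∑ s, φ z w x s y := by
  refine Finset.sum_congr rfl fun z _ => ?_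
  rw [Finset.sum_comm]
  exact Finset.sum_congr rfl fun x _ => Finset.sum_congr rfl fun w _ => Finset.sum_comm

lemma sum_exchange_pairs (φ : V → V → V → V → V → ℝ) :
    ∑ z, ∑ x, ∑ w, ∑ y, ∑ s, φ z x w y s = ∑ z, ∑ x, ∑ w, ∑ y, ∑ s, φ z y s x w := by
  refine Finset.sum_congr rfl fun z _ => ?_
  have h1 : ∀ ψ : V → V → V → V → ℝ, ∑ x, ∑ w, ∑ y, ∑ s, ψ x w y s =
      ∑ p : V × V, ∑ r : V × V, ψ p.1 p.2 r.1 r.2 := fun ψ => by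
    simp only [Fintype.sum_prod_type]
  rw [h1, h1 fun x w y s => φ z y s x w, Finset.sum_comm]

/-- The triangle operator is bounded from `ℓ² × ℓ²` to `ℓ²`. -/
lemma sum_triangle_sq_le (h : SparseKernel e n) (u v : V → ℝ) :
    ∑ z, (∑ x, ∑ w, triangle e z x w * (u x * v w)) ^ 2 ≤
      8 * (∑ x, u x ^ 2) ^ 2 + 8 * (∑ x, v x ^ 2) ^ 2 +
        16 * ((∑ x, u x ^ 2) * ∑ x, v x ^ 2) := by
  classical
  set A : V → ℝ := fun x => u x ^ 2 with hA
  set B : V → ℝ := fun x => v x ^ 2 with hB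
  have hA0 : ∀ x, 0 ≤ A x := fun x => sq_nonneg _
  have hB0 : ∀ x, 0 ≤ B x := fun x => sq_nonneg _
  -- The square counts pairs of triangles sharing z. When x ≠ y and w ≠ s, the product is split by
  -- AM-GM as u_x²u_y² + v_w²v_s²; when x = y or w = s, it is split as u_x²v_w² + u_y²v_s².
  have key : ∀ z, (∑ x, ∑ w, triangle e z x w * (u x * v w)) ^ 2 ≤
      ∑ x, ∑ w, ∑ y, ∑ s, (triangle e z x w * triangle e z y s *
          (if x = y then 0 else A x * A y) +
        triangle e z x w * triangle e z y s * (if w = s then 0 else B w * B s) +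
        triangle e z x w * triangle e z y s * (if x = y then A x * B w else 0) +
        triangle e z x w * triangle e z y s * (if y = x then A y * B s else 0) +
        triangle e z x w * triangle e z y s * (if w = s then B w * A x else 0) +
        triangle e z x w * triangle e z y s * (if s = w then B s * A y else 0)) := by
    intro z
    have h1 : (∑ x, ∑ w, triangle e z x w * (u x * v w)) ^ 2 = ∑ x, ∑ w, ∑ y, ∑ s,
        (triangle e z x w * triangle e z y s) * ((u x * v w) * (u y * v s)) := by
      simp only [sq, Finset.sum_mul]
      refine Finset.sum_congr rfl fun x _ => Finset.sum_congr rfl fun w _ => ?_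
      simp only [Finset.mul_sum]
      exact Finset.sum_congr rfl fun y _ => Finset.sum_congr rfl fun s _ => by ring
    rw [h1]
    refine Finset.sum_le_sum fun x _ => Finset.sum_le_sum fun w _ =>
      Finset.sum_le_sum fun y _ => Finset.sum_le_sum fun s _ => ?_
    simp only [← mul_add]
    refine mul_le_mul_of_nonneg_left ?_
      (mul_nonneg (h.triangle_nonneg _ _ _) (h.triangle_nonneg _ _ _))
    have e1 : (u x * v w) * (u y * v s) ≤ A x * A y + B w * B s := by
      simp only [hA, hB]
      nlinarith [sq_nonneg (u x * u y - v w * v s), sq_nonneg (u x * u y), sq_nonneg (v w * v s)]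
    have e2 : (u x * v w) * (u y * v s) ≤ A x * B w + A y * B s := by
      simp only [hA, hB]
      nlinarith [sq_nonneg (u x * v w - u y * v s), sq_nonneg (u x * v w), sq_nonneg (u y * v s)]
    have n1 := mul_nonneg (hA0 x) (hA0 y)
    have n2 := mul_nonneg (hB0 w) (hB0 s)
    have n3 := mul_nonneg (hA0 x) (hB0 w)
    have n4 := mul_nonneg (hA0 y) (hB0 s)
    rw [eq_comm (a := y) (b := x), eq_comm (a := s) (b := w), mul_comm (B w) (A x),
      mul_comm (B s) (A y)]
    split_ifs <;> linarith
  refine (Finset.sum_le_sum fun z _ => key z).trans ?_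
  simp only [Finset.sum_add_distrib]
  have s1 := h.sum_triangle_pair_ne_le A hA0
  have s2 : ∑ z, ∑ x, ∑ w, ∑ y, ∑ s, triangle e z x w * triangle e z y s *
      (if w = s then 0 else B w * B s) ≤ 8 * (∑ x, B x) ^ 2 := by
    rw [sum_swap_pairs]
    simpa only [h.triangle_swap _ _ _] using h.sum_triangle_pair_ne_le B hB0
  have s3 := h.sum_triangle_pair_eq_le A B hA0 hB0
  have s4 : ∑ z, ∑ x, ∑ w, ∑ y, ∑ s, triangle e z x w * triangle e z y s *
      (if y = x then A y * B s else 0) ≤ 4 * ((∑ x, A x) * ∑ x, B x) := by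
    rw [sum_exchange_pairs]
    simpa only [mul_comm (triangle e _ _ _) (triangle e _ _ _)] using s3
  have s5 : ∑ z, ∑ x, ∑ w, ∑ y, ∑ s, triangle e z x w * triangle e z y s *
      (if w = s then B w * A x else 0) ≤ 4 * ((∑ x, B x) * ∑ x, A x) := by
    rw [sum_swap_pairs]
    simpa only [h.triangle_swap _ _ _] using h.sum_triangle_pair_eq_le B A hB0 hA0
  have s6 : ∑ z, ∑ x, ∑ w, ∑ y, ∑ s, triangle e z x w * triangle e z y s *
      (if s = w then B s * A y else 0) ≤ 4 * ((∑ x, B x) * ∑ x, A x) := by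
    rw [sum_exchange_pairs]
    simpa only [mul_comm (triangle e _ _ _) (triangle e _ _ _)] using s5
  rw [mul_comm (∑ x, B x)] at s5 s6
  linarith

/-- The averaging operator is bounded from `L^(3/2)` to `L³`. -/
lemma sum_average_cube_le (h : SparseKernel e n) (a : V → ℝ) (ha1 : ∀ x, 1 ≤ a x)
    (ha : ∑ x, a x ^ 3 ≤ 2 * n ^ 2) :
    ∑ z, (∑ x, e z x * a x ^ 2) ^ 3 ≤ 104 * n ^ 5 := by
  classical
  have hn := h.one_le
  set f : V → ℝ := fun x => a x ^ 3 with hf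
  have ha0 : ∀ x, 0 ≤ a x := fun x => zero_le_one.trans (ha1 x)
  have hf0 : ∀ x, 0 ≤ f x := fun x => pow_nonneg (ha0 x) 3
  have han : ∀ x, a x ≤ 2 * n := by
    intro x
    have h1 : f x ≤ 2 * n ^ 2 :=
      (Finset.single_le_sum (fun y _ => hf0 y) (Finset.mem_univ x)).trans ha
    by_contra! hlt
    have h2 : (2 * n) ^ 3 ≤ a x ^ 3 := pow_le_pow_left₀ (by linarith) hlt.le 3
    have h3 : n ^ 2 * 1 ≤ n ^ 2 * n := mul_le_mul_of_nonneg_left hn (sq_nonneg n)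
    have h4 : 0 < n ^ 2 := by positivity
    simp only [hf] at h1
    nlinarith
  -- The first factor controls pairs of distinct points. The extra 2n at w = y pays for triples with
  -- a repeated point, and costs no more than the free sum over w, which is also at most 2n.
  set W : V → V → V → ℝ := fun x y w =>
    (if x = y then 0 else f x * f y) * (1 + if w = y then 2 * n else 0) with hW
  have hWn : ∀ x y w, 0 ≤ W x y w := by
    intro x y w
    refine mul_nonneg ?_ ?_
    · split_ifs
      · exact le_rfl
      · exact mul_nonneg (hf0 x) (hf0 y)
    · split_ifs <;> linarith
  have hpt : ∀ x y w, a x ^ 2 * a y ^ 2 * a w ^ 2 ≤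
      W x y w + W y w x + W w x y + (if x = y then if x = w then f x ^ 2 else 0 else 0) := by
    -- The left side is f_x f_y · (a_x / a_y), and a_x ≤ 2n, a_y ≥ 1.
    have hrep : ∀ x y, a x ^ 4 * a y ^ 2 ≤ f x * f y * (1 + 2 * n) := by
      intro x y
      have h1 : a x * 1 ≤ (2 * n) * a y :=
        mul_le_mul (han x) (ha1 y) zero_le_one (by linarith)
      have h2 : 0 ≤ a x ^ 3 * a y ^ 2 := mul_nonneg (pow_nonneg (ha0 x) 3) (sq_nonneg _)
      have h3 := mul_nonneg (hf0 x) (hf0 y)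
      have h4 := mul_le_mul_of_nonneg_left h1 h2
      simp only [hf] at *
      nlinarith
    intro x y w
    by_cases hxy : x = y
    · subst hxy
      by_cases hxw : x = w
      · subst hxw
        simp only [hW, hf, if_true, zero_mul, zero_add]
        exact le_of_eq (by ring)
      · have := hrep x w
        have h1 := hWn x w x
        have h2 : W w x x = f x * f w * (1 + 2 * n) := by
          simp [hW, Ne.symm hxw, mul_comm]
        have h3 := hWn x x w
        simp only [if_neg hxw, if_true, add_zero]
        nlinarith
    · rw [if_neg hxy, add_zero]
      by_cases hyw : y = w
      · subst hyw
        have := hrep y x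
        have h1 := hWn y y x
        have h2 : W x y y = f y * f x * (1 + 2 * n) := by
          simp [hW, hxy, mul_comm]
        have h3 := hWn y x y
        nlinarith
      · by_cases hxw : x = w
        · subst hxw
          have := hrep x y
          have h1 := hWn x y x
          have h2 : W y x x = f x * f y * (1 + 2 * n) := by
            simp [hW, Ne.symm hxy, mul_comm]
          have h3 := hWn x x y
          nlinarith
        · have e1 : f x * f y ≤ W x y w := by simp [hW, hxy, Ne.symm hyw]
          have e2 : f y * f w ≤ W y w x := by simp [hW, hyw, hxw]
          have e3 : f w * f x ≤ W w x y := by simp [hW, Ne.symm hxw, Ne.symm hxy]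
          -- For distinct points, AM-GM is applied to the three products a_x a_y, a_y a_w, a_w a_x,
          -- whose cubes are the products of values of f.
          have p := mul_nonneg (ha0 x) (ha0 y)
          have q := mul_nonneg (ha0 y) (ha0 w)
          have r := mul_nonneg (ha0 w) (ha0 x)
          have amgm : ∀ p q r : ℝ, 0 ≤ p → 0 ≤ q → 0 ≤ r →
              p * q * r ≤ p ^ 3 + q ^ 3 + r ^ 3 := by
            intro p q r hp hq hr
            nlinarith [mul_nonneg hp (sq_nonneg (p - q)), mul_nonneg hp (sq_nonneg (p - r)),
              mul_nonneg hq (sq_nonneg (p - q)), mul_nonneg hq (sq_nonneg (q - r)),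
              mul_nonneg hr (sq_nonneg (q - r)), mul_nonneg hr (sq_nonneg (p - r)),
              mul_nonneg (add_nonneg (add_nonneg hp hq) hr) (sq_nonneg (p - q)),
              mul_nonneg (add_nonneg (add_nonneg hp hq) hr) (sq_nonneg (q - r)),
              mul_nonneg (add_nonneg (add_nonneg hp hq) hr) (sq_nonneg (p - r)),
              pow_nonneg hp 3, pow_nonneg hq 3, pow_nonneg hr 3]
          have := amgm _ _ _ p q r
          simp only [hf] at e1 e2 e3
          nlinarith
  have hWs : ∑ z, ∑ x, ∑ y, ∑ w, e z x * e z y * e z w * W x y w ≤ 32 * n ^ 5 := by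
    have h1 : ∀ z x y, ∑ w, e z x * e z y * e z w * W x y w ≤
        4 * n * (e z x * e z y * (if x = y then 0 else f x * f y)) := by
      intro z x y
      have h2 : ∑ w, e z w * (1 + if w = y then 2 * n else 0) ≤ 4 * n := by
        simp only [mul_add, mul_one, Finset.sum_add_distrib, mul_ite, mul_zero,
          Finset.sum_ite_eq', Finset.mem_univ, if_true]
        nlinarith [h.degree z, h.le_one z y]
      have h3 : 0 ≤ e z x * e z y * (if x = y then 0 else f x * f y) := by
        refine mul_nonneg (mul_nonneg (h.nonneg _ _) (h.nonneg _ _)) ?_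
        split_ifs
        · exact le_rfl
        · exact mul_nonneg (hf0 x) (hf0 y)
      calc _ = e z x * e z y * (if x = y then 0 else f x * f y) *
            ∑ w, e z w * (1 + if w = y then 2 * n else 0) := by
            rw [Finset.mul_sum]
            exact Finset.sum_congr rfl fun w _ => by simp only [hW]; ring
        _ ≤ _ := by nlinarith
    refine (Finset.sum_le_sum fun z _ => Finset.sum_le_sum fun x _ =>
      Finset.sum_le_sum fun y _ => h1 z x y).trans ?_
    simp only [← Finset.mul_sum]
    have h4 := h.sum_pair_le f hf0
    have h5 : (∑ x, f x) ^ 2 ≤ (2 * n ^ 2) ^ 2 :=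
      pow_le_pow_left₀ (Finset.sum_nonneg fun x _ => hf0 x) ha 2
    calc _ ≤ 4 * n * (2 * (2 * n ^ 2) ^ 2) :=
          mul_le_mul_of_nonneg_left (by linarith) (by linarith)
      _ = _ := by ring
  have hdiag : ∑ z, ∑ x, ∑ y, ∑ w, e z x * e z y * e z w *
      (if x = y then if x = w then f x ^ 2 else 0 else 0) ≤ 8 * n ^ 5 := by
    have h1 : ∀ z x, ∑ y, ∑ w, e z x * e z y * e z w *
        (if x = y then if x = w then f x ^ 2 else 0 else 0) ≤ e z x * f x ^ 2 := by
      intro z x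
      rw [Finset.sum_eq_single x, Finset.sum_eq_single x]
      · simp only [if_true]
        have := h.nonneg z x
        have := h.le_one z x
        have h2 : e z x * e z x ≤ 1 := by nlinarith
        have h3 : e z x * e z x * e z x ≤ e z x := by nlinarith
        exact mul_le_mul_of_nonneg_right h3 (sq_nonneg _)
      · intro w _ hw; simp [Ne.symm hw]
      · simp
      · intro y _ hy; simp [Ne.symm hy]
      · simp
    refine (Finset.sum_le_sum fun z _ => Finset.sum_le_sum fun x _ => h1 z x).trans ?_
    rw [Finset.sum_comm]
    have h2 : ∀ x, ∑ z, e z x * f x ^ 2 ≤ 2 * n * (2 * n ^ 2) * f x := by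
      intro x
      have h3 : f x ≤ 2 * n ^ 2 :=
        (Finset.single_le_sum (fun y _ => hf0 y) (Finset.mem_univ x)).trans ha
      rw [← Finset.sum_mul]
      have h4 : ∑ z, e z x ≤ 2 * n := by simpa only [h.symm _ x] using h.degree x
      calc _ ≤ 2 * n * f x ^ 2 := mul_le_mul_of_nonneg_right h4 (sq_nonneg _)
        _ = 2 * n * f x * f x := by ring
        _ ≤ 2 * n * (2 * n ^ 2) * f x := by
          refine mul_le_mul_of_nonneg_right ?_ (hf0 x)
          exact mul_le_mul_of_nonneg_left h3 (by linarith)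
    refine (Finset.sum_le_sum fun x _ => h2 x).trans ?_
    rw [← Finset.mul_sum]
    calc _ ≤ 2 * n * (2 * n ^ 2) * (2 * n ^ 2) := mul_le_mul_of_nonneg_left ha (by positivity)
      _ = _ := by ring
  have hexp : ∀ z, (∑ x, e z x * a x ^ 2) ^ 3 ≤ ∑ x, ∑ y, ∑ w,
      (e z x * e z y * e z w * W x y w + e z x * e z y * e z w * W y w x +
        e z x * e z y * e z w * W w x y + e z x * e z y * e z w *
      (if x = y then if x = w then f x ^ 2 else 0 else 0)) := by
    intro z
    have h1 : (∑ x, e z x * a x ^ 2) ^ 3 = ∑ x, ∑ y, ∑ w,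
        e z x * e z y * e z w * (a x ^ 2 * a y ^ 2 * a w ^ 2) := by
      rw [pow_succ, sq, Finset.sum_mul_sum, Finset.sum_mul]
      refine Finset.sum_congr rfl fun x _ => ?_
      rw [Finset.sum_mul]
      refine Finset.sum_congr rfl fun y _ => ?_
      rw [Finset.mul_sum]
      exact Finset.sum_congr rfl fun w _ => by ring
    rw [h1]
    refine Finset.sum_le_sum fun x _ => Finset.sum_le_sum fun y _ =>
      Finset.sum_le_sum fun w _ => ?_
    simp only [← mul_add]
    exact mul_le_mul_of_nonneg_left (hpt x y w)
      (mul_nonneg (mul_nonneg (h.nonneg _ _) (h.nonneg _ _)) (h.nonneg _ _))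
  refine (Finset.sum_le_sum fun z _ => hexp z).trans ?_
  simp only [Finset.sum_add_distrib]
  have r1 : ∑ z, ∑ x, ∑ y, ∑ w, e z x * e z y * e z w * W w x y =
      ∑ z, ∑ x, ∑ y, ∑ w, e z x * e z y * e z w * W x y w := by
    refine Finset.sum_congr rfl fun z _ => ?_
    have : ∀ x, ∑ y, ∑ w, e z x * e z y * e z w * W w x y =
      ∑ w, ∑ y, e z x * e z y * e z w * W w x y := fun x => Finset.sum_comm
    simp only [this]
    rw [Finset.sum_comm]
    exact Finset.sum_congr rfl fun x _ => Finset.sum_congr rfl fun y _ =>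
      Finset.sum_congr rfl fun w _ => by ring
  have r2 : ∑ z, ∑ x, ∑ y, ∑ w, e z x * e z y * e z w * W y w x =
      ∑ z, ∑ x, ∑ y, ∑ w, e z x * e z y * e z w * W x y w := by
    refine Finset.sum_congr rfl fun z _ => ?_
    rw [Finset.sum_comm]
    refine Finset.sum_congr rfl fun x _ => ?_
    rw [Finset.sum_comm]
    exact Finset.sum_congr rfl fun y _ => Finset.sum_congr rfl fun w _ => by ring
  rw [r1, r2]
  linarith

end SparseKernel

/-! ### The kite form and its convex set of admissible exponents. -/

/-- The unnormalized kite form of a kernel. -/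
def kiteSum {V : Type*} [Fintype V] (e : V → V → ℝ) (f₁ f₂ f₃ f₄ : V → ℝ) : ℝ :=
  ∑ x₁, ∑ x₂, ∑ x₃, ∑ x₄, e x₁ x₂ * e x₂ x₃ * e x₃ x₄ * e x₃ x₁ *
    (f₁ x₁ * f₂ x₂ * f₃ x₃ * f₄ x₄)

/-- The exponents `a` for which the kite form of `F₁ ^ a₁, …, F₄ ^ a₄` is at most `C * n ^ 4`
whenever the functions `F_j ≥ 1` have mean at most `2`. -/
def kiteExponents {V : Type*} [Fintype V] (e : V → V → ℝ) (n C : ℝ) : Set (Fin 4 → ℝ) :=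
  {a | ∀ F : Fin 4 → V → ℝ, (∀ j x, 1 ≤ F j x) → (∀ j, ∑ x, F j x ≤ 2 * n ^ 2) →
    kiteSum e (fun x => F 0 x ^ a 0) (fun x => F 1 x ^ a 1) (fun x => F 2 x ^ a 2)
      (fun x => F 3 x ^ a 3) ≤ C * n ^ 4}

namespace SparseKernel

variable {V : Type*} [Fintype V] {e : V → V → ℝ} {n : ℝ}

lemma kiteSum_mono (h : SparseKernel e n) {f₁ f₂ f₃ f₄ g₁ g₂ g₃ g₄ : V → ℝ}
    (hf₁ : ∀ x, 0 ≤ f₁ x) (hf₂ : ∀ x, 0 ≤ f₂ x) (hf₃ : ∀ x, 0 ≤ f₃ x) (hf₄ : ∀ x, 0 ≤ f₄ x)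
    (h₁ : ∀ x, f₁ x ≤ g₁ x) (h₂ : ∀ x, f₂ x ≤ g₂ x) (h₃ : ∀ x, f₃ x ≤ g₃ x)
    (h₄ : ∀ x, f₄ x ≤ g₄ x) : kiteSum e f₁ f₂ f₃ f₄ ≤ kiteSum e g₁ g₂ g₃ g₄ := by
  refine Finset.sum_le_sum fun x _ => Finset.sum_le_sum fun y _ =>
    Finset.sum_le_sum fun z _ => Finset.sum_le_sum fun w _ => ?_
  refine mul_le_mul_of_nonneg_left ?_ ?_
  · have g1 := (hf₁ x).trans (h₁ x)
    have g2 := (hf₂ y).trans (h₂ y)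
    have g3 := (hf₃ z).trans (h₃ z)
    exact mul_le_mul (mul_le_mul (mul_le_mul (h₁ x) (h₂ y) (hf₂ y) g1) (h₃ z) (hf₃ z)
      (mul_nonneg g1 g2)) (h₄ w) (hf₄ w) (mul_nonneg (mul_nonneg g1 g2) g3)
  · exact mul_nonneg (mul_nonneg (mul_nonneg (h.nonneg _ _) (h.nonneg _ _)) (h.nonneg _ _))
      (h.nonneg _ _)

/-- Each summand is a nonnegative weight times the exponential of a linear form in the exponents,
hence convex in them. This replaces interpolation and keeps the constant. -/
lemma kiteExponents_convex (h : SparseKernel e n) (C : ℝ) : Convex ℝ (kiteExponents e n C) := by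
  intro a ha b hb s r hs hr hsr F hF1 hF
  have hA := mul_le_mul_of_nonneg_left (ha F hF1 hF) hs
  have hB := mul_le_mul_of_nonneg_left (hb F hF1 hF) hr
  have hpos : ∀ j x, 0 < F j x := fun j x => zero_lt_one.trans_le (hF1 j x)
  have hexp : ∀ (c : Fin 4 → ℝ) x y z w, F 0 x ^ c 0 * F 1 y ^ c 1 * F 2 z ^ c 2 * F 3 w ^ c 3 =
      Real.exp (Real.log (F 0 x) * c 0 + Real.log (F 1 y) * c 1 + Real.log (F 2 z) * c 2 +
        Real.log (F 3 w) * c 3) := by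
    intro c x y z w
    simp only [Real.rpow_def_of_pos (hpos _ _), Real.exp_add]
  have key : kiteSum e (fun x => F 0 x ^ (s • a + r • b) 0) (fun x => F 1 x ^ (s • a + r • b) 1)
      (fun x => F 2 x ^ (s • a + r • b) 2) (fun x => F 3 x ^ (s • a + r • b) 3) ≤
      s * kiteSum e (fun x => F 0 x ^ a 0) (fun x => F 1 x ^ a 1) (fun x => F 2 x ^ a 2)
        (fun x => F 3 x ^ a 3) +
      r * kiteSum e (fun x => F 0 x ^ b 0) (fun x => F 1 x ^ b 1) (fun x => F 2 x ^ b 2)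
        (fun x => F 3 x ^ b 3) := by
    simp only [kiteSum, Finset.mul_sum, ← Finset.sum_add_distrib]
    refine Finset.sum_le_sum fun x _ => Finset.sum_le_sum fun y _ =>
      Finset.sum_le_sum fun z _ => Finset.sum_le_sum fun w _ => ?_
    have hE : 0 ≤ e x y * e y z * e z w * e z x :=
      mul_nonneg (mul_nonneg (mul_nonneg (h.nonneg _ _) (h.nonneg _ _)) (h.nonneg _ _))
        (h.nonneg _ _)
    rw [hexp, hexp, hexp]
    have hc := convexOn_exp.2 (Set.mem_univ (Real.log (F 0 x) * a 0 + Real.log (F 1 y) * a 1 +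
      Real.log (F 2 z) * a 2 + Real.log (F 3 w) * a 3)) (Set.mem_univ (Real.log (F 0 x) * b 0 +
      Real.log (F 1 y) * b 1 + Real.log (F 2 z) * b 2 + Real.log (F 3 w) * b 3)) hs hr hsr
    simp only [smul_eq_mul] at hc
    have heq : Real.log (F 0 x) * (s • a + r • b) 0 + Real.log (F 1 y) * (s • a + r • b) 1 +
        Real.log (F 2 z) * (s • a + r • b) 2 + Real.log (F 3 w) * (s • a + r • b) 3 =
        s * (Real.log (F 0 x) * a 0 + Real.log (F 1 y) * a 1 +
          Real.log (F 2 z) * a 2 + Real.log (F 3 w) * a 3) +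
        r * (Real.log (F 0 x) * b 0 + Real.log (F 1 y) * b 1 +
          Real.log (F 2 z) * b 2 + Real.log (F 3 w) * b 3) := by
      simp only [Pi.add_apply, Pi.smul_apply, smul_eq_mul]; ring
    rw [heq]
    calc _ ≤ _ := mul_le_mul_of_nonneg_left hc hE
      _ = _ := by ring
  calc _ ≤ _ := key
    _ ≤ _ := add_le_add hA hB
    _ = (s + r) * (C * n ^ 4) := by ring
    _ = _ := by rw [hsr, one_mul]

lemma kiteExponents_of_le (h : SparseKernel e n) {C : ℝ} {a b : Fin 4 → ℝ}
    (ha : a ∈ kiteExponents e n C) (hab : ∀ j, b j ≤ a j) : b ∈ kiteExponents e n C := by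
  intro F hF1 hF
  refine le_trans ?_ (ha F hF1 hF)
  have h0 : ∀ j x, 0 ≤ F j x ^ b j := fun j x =>
    Real.rpow_nonneg (zero_le_one.trans (hF1 j x)) _
  have h1 : ∀ j x, F j x ^ b j ≤ F j x ^ a j := fun j x =>
    Real.rpow_le_rpow_of_exponent_le (hF1 j x) (hab j)
  exact h.kiteSum_mono (h0 0) (h0 1) (h0 2) (h0 3) (h1 0) (h1 1) (h1 2) (h1 3)

lemma kiteSum_swap (h : SparseKernel e n) (f₁ f₂ f₃ f₄ : V → ℝ) :
    kiteSum e f₁ f₂ f₃ f₄ = kiteSum e f₂ f₁ f₃ f₄ := by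
  rw [kiteSum, Finset.sum_comm]
  refine Finset.sum_congr rfl fun x _ => Finset.sum_congr rfl fun y _ =>
    Finset.sum_congr rfl fun z _ => Finset.sum_congr rfl fun w _ => ?_
  rw [h.symm y x, h.symm x z, h.symm z y]
  ring

/-- A free tail contributes only the degree of its hinge, leaving the triangle form. -/
lemma kiteSum_one_right_le (h : SparseKernel e n) {f₁ f₂ f₃ : V → ℝ}
    (hf₁ : ∀ x, 0 ≤ f₁ x) (hf₂ : ∀ x, 0 ≤ f₂ x) (hf₃ : ∀ x, 0 ≤ f₃ x) :
    kiteSum e f₁ f₂ f₃ (fun _ => 1) ≤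
      2 * n * ∑ z, f₃ z * ∑ x, ∑ w, triangle e z x w * (f₁ x * f₂ w) := by
  have h1 : ∀ x y z, ∑ w, e x y * e y z * e z w * e z x * (f₁ x * f₂ y * f₃ z * 1) ≤
      2 * n * (f₃ z * (triangle e z x y * (f₁ x * f₂ y))) := by
    intro x y z
    calc _ = (f₃ z * (triangle e z x y * (f₁ x * f₂ y))) * ∑ w, e z w := by
          rw [Finset.mul_sum]
          exact Finset.sum_congr rfl fun w _ => by simp only [triangle]; ring
      _ ≤ (f₃ z * (triangle e z x y * (f₁ x * f₂ y))) * (2 * n) :=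
          mul_le_mul_of_nonneg_left (h.degree z) (mul_nonneg (hf₃ z)
            (mul_nonneg (h.triangle_nonneg _ _ _) (mul_nonneg (hf₁ x) (hf₂ y))))
      _ = _ := by ring
  refine (Finset.sum_le_sum fun x _ => Finset.sum_le_sum fun y _ =>
    Finset.sum_le_sum fun z _ => h1 x y z).trans (le_of_eq ?_)
  simp only [← Finset.mul_sum]
  congr 1
  simp only [Finset.mul_sum]
  rw [Finset.sum_comm' (t' := Finset.univ) (s' := fun _ => Finset.univ) (by simp)]
  have : ∀ y, ∑ x, ∑ z, f₃ z * (triangle e z x y * (f₁ x * f₂ y)) =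
    ∑ z, ∑ x, f₃ z * (triangle e z x y * (f₁ x * f₂ y)) := fun y => Finset.sum_comm
  simp only [this]
  rw [Finset.sum_comm]
  exact Finset.sum_congr rfl fun z _ => Finset.sum_comm

/-- A free second vertex is a common neighbour of the first and third, so it costs a factor 2 and
leaves two averages at the third vertex. -/
lemma kiteSum_one_second_le (h : SparseKernel e n) {f₁ f₃ f₄ : V → ℝ}
    (hf₁ : ∀ x, 0 ≤ f₁ x) (hf₃ : ∀ x, 0 ≤ f₃ x) (hf₄ : ∀ x, 0 ≤ f₄ x) :
    kiteSum e f₁ (fun _ => 1) f₃ f₄ ≤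
      2 * ∑ z, f₃ z * (∑ x, e z x * f₁ x) * ∑ w, e z w * f₄ w := by
  have h1 : ∀ x z w, ∑ y, e x y * e y z * e z w * e z x * (f₁ x * 1 * f₃ z * f₄ w) ≤
      2 * (f₃ z * (e z x * f₁ x) * (e z w * f₄ w)) := by
    intro x z w
    have hP : 0 ≤ f₁ x * f₃ z * (e z w * f₄ w) :=
      mul_nonneg (mul_nonneg (hf₁ x) (hf₃ z)) (mul_nonneg (h.nonneg _ _) (hf₄ w))
    calc _ = (f₁ x * f₃ z * (e z w * f₄ w)) * ∑ y, triangle e z x y := by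
          rw [Finset.mul_sum]
          exact Finset.sum_congr rfl fun y _ => by simp only [triangle]; ring
      _ ≤ (f₁ x * f₃ z * (e z w * f₄ w)) * (2 * e z x) :=
          mul_le_mul_of_nonneg_left (h.sum_triangle_le z x) hP
      _ = _ := by ring
  have h2 : kiteSum e f₁ (fun _ => 1) f₃ f₄ = ∑ z, ∑ x, ∑ w, ∑ y,
      e x y * e y z * e z w * e z x * (f₁ x * 1 * f₃ z * f₄ w) := by
    rw [kiteSum, Finset.sum_comm (s := Finset.univ) (t := Finset.univ)
      (f := fun z x => ∑ w, ∑ y, e x y * e y z * e z w * e z x * (f₁ x * 1 * f₃ z * f₄ w))]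
    refine Finset.sum_congr rfl fun x _ => ?_
    rw [Finset.sum_comm]
    exact Finset.sum_congr rfl fun z _ => Finset.sum_comm
  rw [h2]
  refine (Finset.sum_le_sum fun z _ => Finset.sum_le_sum fun x _ =>
    Finset.sum_le_sum fun w _ => h1 x z w).trans (le_of_eq ?_)
  simp only [← Finset.mul_sum, ← Finset.sum_mul]

lemma kiteSum_one_one_right_le (h : SparseKernel e n) {f₁ f₂ : V → ℝ}
    (hf₁ : ∀ x, 0 ≤ f₁ x) (hf₂ : ∀ x, 0 ≤ f₂ x) :
    kiteSum e f₁ f₂ (fun _ => 1) (fun _ => 1) ≤ 4 * n * ∑ x, f₁ x * ∑ y, e x y * f₂ y := by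
  have hn := h.one_le
  refine (h.kiteSum_one_right_le hf₁ hf₂ fun _ => zero_le_one).trans ?_
  have h1 : ∑ z, ∑ x, ∑ w, triangle e z x w * (f₁ x * f₂ w) ≤
      2 * ∑ x, f₁ x * ∑ y, e x y * f₂ y := by
    rw [Finset.sum_comm, Finset.mul_sum]
    refine Finset.sum_le_sum fun x _ => ?_
    rw [Finset.sum_comm, Finset.mul_sum, Finset.mul_sum]
    refine Finset.sum_le_sum fun w _ => ?_
    rw [← Finset.sum_mul]
    have h2 : ∑ z, triangle e z x w ≤ 2 * e x w := by
      simp only [triangle_rotate (e := e) _ x w]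
      exact h.sum_triangle_le x w
    nlinarith [mul_nonneg (hf₁ x) (hf₂ w)]
  simp only [one_mul]
  nlinarith

/-- The averaging operator is bounded on `L^(3/2) × L^(3/2)`. -/
lemma sum_bilinear_le (h : SparseKernel e n) (a b : V → ℝ) (ha1 : ∀ x, 1 ≤ a x)
    (hb1 : ∀ x, 1 ≤ b x) (ha : ∑ x, a x ^ 3 ≤ 2 * n ^ 2) (hb : ∑ x, b x ^ 3 ≤ 2 * n ^ 2) :
    ∑ z, b z ^ 2 * ∑ x, e z x * a x ^ 2 ≤ 106 * n ^ 3 := by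
  have hn := h.one_le
  have hn0 : 0 < n := by linarith
  have hcube := h.sum_average_cube_le a ha1 ha
  -- Young's inequality b²T ≤ b³ + T³ with T = S/n; after this rescaling both sums are of order n³.
  have h1 : ∀ z, b z ^ 2 * ∑ x, e z x * a x ^ 2 ≤
      n * b z ^ 3 + (n ^ 2)⁻¹ * (∑ x, e z x * a x ^ 2) ^ 3 := by
    intro z
    have hb0 : 0 ≤ b z := zero_le_one.trans (hb1 z)
    have hs : 0 ≤ ∑ x, e z x * a x ^ 2 :=
      Finset.sum_nonneg fun x _ => mul_nonneg (h.nonneg _ _) (sq_nonneg _)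
    set S := ∑ x, e z x * a x ^ 2
    have hS : S = n * (S / n) := by field_simp
    have ht : 0 ≤ S / n := div_nonneg hs hn0.le
    set T := S / n
    rw [hS]
    have : b z ^ 2 * T ≤ b z ^ 3 + T ^ 3 := by
      nlinarith [mul_nonneg hb0 (sq_nonneg (b z - T)), mul_nonneg ht (sq_nonneg (b z - T)),
        pow_nonneg hb0 3, pow_nonneg ht 3, mul_nonneg hb0 (mul_nonneg hb0 ht)]
    calc _ = n * (b z ^ 2 * T) := by ring
      _ ≤ n * (b z ^ 3 + T ^ 3) := mul_le_mul_of_nonneg_left this hn0.le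
      _ = _ := by field_simp
  refine (Finset.sum_le_sum fun z _ => h1 z).trans ?_
  rw [Finset.sum_add_distrib, ← Finset.mul_sum, ← Finset.mul_sum]
  calc _ ≤ n * (2 * n ^ 2) + (n ^ 2)⁻¹ * (104 * n ^ 5) :=
        add_le_add (mul_le_mul_of_nonneg_left hb hn0.le)
          (mul_le_mul_of_nonneg_left hcube (by positivity))
    _ = _ := by field_simp; ring

lemma sum_sum_mul_le (h : SparseKernel e n) {f : V → ℝ} (hf0 : ∀ x, 0 ≤ f x)
    (hf : ∑ x, f x ≤ 2 * n ^ 2) : ∑ z, ∑ x, e z x * f x ≤ 4 * n ^ 3 := by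
  have hn := h.one_le
  rw [Finset.sum_comm]
  have h1 : ∀ x, ∑ z, e z x * f x ≤ 2 * n * f x := by
    intro x
    rw [← Finset.sum_mul]
    refine mul_le_mul_of_nonneg_right ?_ (hf0 x)
    simpa only [h.symm _ x] using h.degree x
  refine (Finset.sum_le_sum fun x _ => h1 x).trans ?_
  rw [← Finset.mul_sum]
  calc _ ≤ 2 * n * (2 * n ^ 2) := mul_le_mul_of_nonneg_left hf (by linarith)
    _ = _ := by ring

lemma sum_mul_one_le (h : SparseKernel e n) (z : V) : ∑ x, e z x * 1 ≤ 2 * n := by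
  simpa using h.degree z

end SparseKernel

/-! ### Kite bounds at the vertices of the polytope. -/

lemma rpow_two_thirds {x : ℝ} (hx : 1 ≤ x) : x ^ (2 / 3 : ℝ) = (x ^ (1 / 3 : ℝ)) ^ 2 := by
  rw [← Real.rpow_natCast, ← Real.rpow_mul (by linarith)]; norm_num

lemma rpow_third_cube {x : ℝ} (hx : 1 ≤ x) : (x ^ (1 / 3 : ℝ)) ^ 3 = x := by
  rw [← Real.rpow_natCast, ← Real.rpow_mul (by linarith)]; norm_num

lemma rpow_half_sq {x : ℝ} (hx : 1 ≤ x) : (x ^ (1 / 2 : ℝ)) ^ 2 = x := by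
  rw [← Real.rpow_natCast, ← Real.rpow_mul (by linarith)]; norm_num

namespace SparseKernel

variable {V : Type*} [Fintype V] {e : V → V → ℝ} {n : ℝ}

lemma kiteExponents_swap (h : SparseKernel e n) {C a b c d : ℝ}
    (hm : ![a, b, c, d] ∈ kiteExponents e n C) : ![b, a, c, d] ∈ kiteExponents e n C := by
  intro F hF1 hF
  have := hm ![F 1, F 0, F 2, F 3] (by intro j; fin_cases j <;> simp [hF1])
    (by intro j; fin_cases j <;> simp [hF])
  rw [h.kiteSum_swap]
  simpa using this

lemma mem_kiteExponents_third (h : SparseKernel e n) :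
    ![0, 0, 1, 0] ∈ kiteExponents e n 424 := by
  intro F hF1 hF
  have hn := h.one_le
  have h0 : ∀ j x, 0 ≤ F j x := fun j x => zero_le_one.trans (hF1 j x)
  simp only [Matrix.cons_val, Real.rpow_zero, Real.rpow_one]
  refine (h.kiteSum_one_second_le (fun _ => zero_le_one) (h0 2) (fun _ => zero_le_one)).trans ?_
  have h1 : ∀ z, F 2 z * (∑ x, e z x * 1) * ∑ x, e z x * 1 ≤ 4 * n ^ 2 * F 2 z := by
    intro z
    have hd := h.sum_mul_one_le z
    have hd0 : 0 ≤ ∑ x, e z x * 1 :=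
      Finset.sum_nonneg fun x _ => mul_nonneg (h.nonneg _ _) zero_le_one
    calc _ = F 2 z * ((∑ x, e z x * 1) * ∑ x, e z x * 1) := by ring
      _ ≤ F 2 z * ((2 * n) * (2 * n)) :=
        mul_le_mul_of_nonneg_left (mul_le_mul hd hd hd0 (by linarith)) (h0 2 z)
      _ = _ := by ring
  have h2 := Finset.sum_le_sum fun z (_ : z ∈ Finset.univ) => h1 z
  rw [← Finset.mul_sum] at h2
  have h3 := mul_le_mul_of_nonneg_left (hF 2) (show 0 ≤ 4 * n ^ 2 by positivity)
  have : 0 ≤ n ^ 4 := by positivity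
  nlinarith

lemma mem_kiteExponents_first (h : SparseKernel e n) :
    ![1, 0, 0, 0] ∈ kiteExponents e n 424 := by
  intro F hF1 hF
  have hn := h.one_le
  have h0 : ∀ j x, 0 ≤ F j x := fun j x => zero_le_one.trans (hF1 j x)
  simp only [Matrix.cons_val, Real.rpow_zero, Real.rpow_one]
  refine (h.kiteSum_one_second_le (h0 0) (fun _ => zero_le_one) (fun _ => zero_le_one)).trans ?_
  have h1 : ∀ z, 1 * (∑ x, e z x * F 0 x) * ∑ x, e z x * 1 ≤ 2 * n * ∑ x, e z x * F 0 x := by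
    intro z
    have hd0 : 0 ≤ ∑ x, e z x * F 0 x :=
      Finset.sum_nonneg fun x _ => mul_nonneg (h.nonneg _ _) (h0 0 x)
    nlinarith [h.sum_mul_one_le z]
  have h2 := Finset.sum_le_sum fun z (_ : z ∈ Finset.univ) => h1 z
  rw [← Finset.mul_sum] at h2
  have h3 := mul_le_mul_of_nonneg_left (h.sum_sum_mul_le (h0 0) (hF 0))
    (show 0 ≤ 2 * n by linarith)
  have : 0 ≤ n ^ 4 := by positivity
  nlinarith

lemma mem_kiteExponents_fourth (h : SparseKernel e n) :
    ![0, 0, 0, 1] ∈ kiteExponents e n 424 := by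
  intro F hF1 hF
  have hn := h.one_le
  have h0 : ∀ j x, 0 ≤ F j x := fun j x => zero_le_one.trans (hF1 j x)
  simp only [Matrix.cons_val, Real.rpow_zero, Real.rpow_one]
  refine (h.kiteSum_one_second_le (fun _ => zero_le_one) (fun _ => zero_le_one) (h0 3)).trans ?_
  have h1 : ∀ z, 1 * (∑ x, e z x * 1) * ∑ x, e z x * F 3 x ≤ 2 * n * ∑ x, e z x * F 3 x := by
    intro z
    have hd0 : 0 ≤ ∑ x, e z x * F 3 x :=
      Finset.sum_nonneg fun x _ => mul_nonneg (h.nonneg _ _) (h0 3 x)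
    nlinarith [h.sum_mul_one_le z]
  have h2 := Finset.sum_le_sum fun z (_ : z ∈ Finset.univ) => h1 z
  rw [← Finset.mul_sum] at h2
  have h3 := mul_le_mul_of_nonneg_left (h.sum_sum_mul_le (h0 3) (hF 3))
    (show 0 ≤ 2 * n by linarith)
  have : 0 ≤ n ^ 4 := by positivity
  nlinarith

lemma one_le_rpow_third {U : Type*} {F : U → ℝ} (hF1 : ∀ x, 1 ≤ F x) (x : U) : 1 ≤ F x ^ (1 / 3 : ℝ) :=
  Real.one_le_rpow (hF1 x) (by norm_num)

lemma sum_rpow_third_cube_le {F : V → ℝ} {A : ℝ} (hF1 : ∀ x, 1 ≤ F x) (hF : ∑ x, F x ≤ A) :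
    ∑ x, (F x ^ (1 / 3 : ℝ)) ^ 3 ≤ A := by
  simpa only [rpow_third_cube (hF1 _)] using hF

/-- The free vertices cost 4n, and the L^(3/2) × L^(3/2) bound gives 106n³; this product is the
source of the common constant 424. -/
lemma mem_kiteExponents_first_second (h : SparseKernel e n) :
    ![2 / 3, 2 / 3, 0, 0] ∈ kiteExponents e n 424 := by
  intro F hF1 hF
  have hn := h.one_le
  simp only [Matrix.cons_val, Real.rpow_zero, rpow_two_thirds (hF1 _ _)]
  refine (h.kiteSum_one_one_right_le (fun _ => sq_nonneg _) (fun _ => sq_nonneg _)).trans ?_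
  have h1 := h.sum_bilinear_le _ _ (one_le_rpow_third (hF1 1)) (one_le_rpow_third (hF1 0))
    (sum_rpow_third_cube_le (hF1 1) (hF 1)) (sum_rpow_third_cube_le (hF1 0) (hF 0))
  have h2 := mul_le_mul_of_nonneg_left h1 (show 0 ≤ 4 * n by linarith)
  linarith

lemma mem_kiteExponents_first_third (h : SparseKernel e n) :
    ![2 / 3, 0, 2 / 3, 0] ∈ kiteExponents e n 424 := by
  intro F hF1 hF
  have hn := h.one_le
  simp only [Matrix.cons_val, Real.rpow_zero, rpow_two_thirds (hF1 _ _)]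
  refine (h.kiteSum_one_second_le (fun _ => sq_nonneg _) (fun _ => sq_nonneg _)
    (fun _ => zero_le_one)).trans ?_
  have h1 := h.sum_bilinear_le _ _ (one_le_rpow_third (hF1 0)) (one_le_rpow_third (hF1 2))
    (sum_rpow_third_cube_le (hF1 0) (hF 0)) (sum_rpow_third_cube_le (hF1 2) (hF 2))
  have h2 := mul_le_mul_of_nonneg_left h1 (show 0 ≤ 4 * n by linarith)
  refine le_trans ?_ (h2.trans (by linarith))
  rw [Finset.mul_sum, Finset.mul_sum]
  refine Finset.sum_le_sum fun z _ => ?_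
  have hd0 : 0 ≤ (F 2 z ^ (1 / 3 : ℝ)) ^ 2 * ∑ x, e z x * (F 0 x ^ (1 / 3 : ℝ)) ^ 2 :=
    mul_nonneg (sq_nonneg _) (Finset.sum_nonneg fun x _ => mul_nonneg (h.nonneg _ _) (sq_nonneg _))
  have := mul_le_mul_of_nonneg_left (h.sum_mul_one_le z) hd0
  linarith

lemma mem_kiteExponents_third_fourth (h : SparseKernel e n) :
    ![0, 0, 2 / 3, 2 / 3] ∈ kiteExponents e n 424 := by
  intro F hF1 hF
  have hn := h.one_le
  simp only [Matrix.cons_val, Real.rpow_zero, rpow_two_thirds (hF1 _ _)]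
  refine (h.kiteSum_one_second_le (fun _ => zero_le_one) (fun _ => sq_nonneg _)
    (fun _ => sq_nonneg _)).trans ?_
  have h1 := h.sum_bilinear_le _ _ (one_le_rpow_third (hF1 3)) (one_le_rpow_third (hF1 2))
    (sum_rpow_third_cube_le (hF1 3) (hF 3)) (sum_rpow_third_cube_le (hF1 2) (hF 2))
  have h2 := mul_le_mul_of_nonneg_left h1 (show 0 ≤ 4 * n by linarith)
  refine le_trans ?_ (h2.trans (by linarith))
  rw [Finset.mul_sum, Finset.mul_sum]
  refine Finset.sum_le_sum fun z _ => ?_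
  have hd0 : 0 ≤ (F 2 z ^ (1 / 3 : ℝ)) ^ 2 * ∑ x, e z x * (F 3 x ^ (1 / 3 : ℝ)) ^ 2 :=
    mul_nonneg (sq_nonneg _) (Finset.sum_nonneg fun x _ => mul_nonneg (h.nonneg _ _) (sq_nonneg _))
  have := mul_le_mul_of_nonneg_left (h.sum_mul_one_le z) hd0
  linarith

/-- Hölder with three L³ factors at the third vertex: the function itself and the averages of two
L^(3/2) functions. -/
lemma mem_kiteExponents_hinge (h : SparseKernel e n) :
    ![2 / 3, 0, 1 / 3, 2 / 3] ∈ kiteExponents e n 424 := by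
  intro F hF1 hF
  have hn := h.one_le
  have hn0 : 0 < n := by linarith
  simp only [Matrix.cons_val, Real.rpow_zero, rpow_two_thirds (hF1 _ _)]
  refine (h.kiteSum_one_second_le (fun _ => sq_nonneg _)
    (fun x => zero_le_one.trans (one_le_rpow_third (hF1 2) x)) (fun _ => sq_nonneg _)).trans ?_
  have h1 := h.sum_average_cube_le _ (one_le_rpow_third (hF1 0))
    (sum_rpow_third_cube_le (hF1 0) (hF 0))
  have h2 := h.sum_average_cube_le _ (one_le_rpow_third (hF1 3))
    (sum_rpow_third_cube_le (hF1 3) (hF 3))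
  have h3 := sum_rpow_third_cube_le (hF1 2) (hF 2)
  have hpt : ∀ z, F 2 z ^ (1 / 3 : ℝ) * (∑ x, e z x * (F 0 x ^ (1 / 3 : ℝ)) ^ 2) *
      ∑ x, e z x * (F 3 x ^ (1 / 3 : ℝ)) ^ 2 ≤ n ^ 2 * (F 2 z ^ (1 / 3 : ℝ)) ^ 3 +
        n⁻¹ * (∑ x, e z x * (F 0 x ^ (1 / 3 : ℝ)) ^ 2) ^ 3 +
        n⁻¹ * (∑ x, e z x * (F 3 x ^ (1 / 3 : ℝ)) ^ 2) ^ 3 := by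
    intro z
    have hp : 0 ≤ F 2 z ^ (1 / 3 : ℝ) := zero_le_one.trans (one_le_rpow_third (hF1 2) z)
    have hs : ∀ j, 0 ≤ ∑ x, e z x * (F j x ^ (1 / 3 : ℝ)) ^ 2 := fun j =>
      Finset.sum_nonneg fun x _ => mul_nonneg (h.nonneg _ _) (sq_nonneg _)
    have hq := div_nonneg (hs 0) hn0.le
    have hr := div_nonneg (hs 3) hn0.le
    have e1 : ∑ x, e z x * (F 0 x ^ (1 / 3 : ℝ)) ^ 2 =
      n * ((∑ x, e z x * (F 0 x ^ (1 / 3 : ℝ)) ^ 2) / n) := by field_simp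
    have e2 : ∑ x, e z x * (F 3 x ^ (1 / 3 : ℝ)) ^ 2 =
      n * ((∑ x, e z x * (F 3 x ^ (1 / 3 : ℝ)) ^ 2) / n) := by field_simp
    rw [e1, e2]
    set q := (∑ x, e z x * (F 0 x ^ (1 / 3 : ℝ)) ^ 2) / n
    set r := (∑ x, e z x * (F 3 x ^ (1 / 3 : ℝ)) ^ 2) / n
    set p := F 2 z ^ (1 / 3 : ℝ)
    have amgm : p * q * r ≤ p ^ 3 + q ^ 3 + r ^ 3 := by
      nlinarith [mul_nonneg hp (sq_nonneg (p - q)), mul_nonneg hp (sq_nonneg (p - r)),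
        mul_nonneg hq (sq_nonneg (p - q)), mul_nonneg hq (sq_nonneg (q - r)),
        mul_nonneg hr (sq_nonneg (q - r)), mul_nonneg hr (sq_nonneg (p - r)),
        mul_nonneg (add_nonneg (add_nonneg hp hq) hr) (sq_nonneg (p - q)),
        mul_nonneg (add_nonneg (add_nonneg hp hq) hr) (sq_nonneg (q - r)),
        mul_nonneg (add_nonneg (add_nonneg hp hq) hr) (sq_nonneg (p - r)),
        pow_nonneg hp 3, pow_nonneg hq 3, pow_nonneg hr 3]
    calc _ = n ^ 2 * (p * q * r) := by ring
      _ ≤ n ^ 2 * (p ^ 3 + q ^ 3 + r ^ 3) := mul_le_mul_of_nonneg_left amgm (by positivity)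
      _ = _ := by field_simp
  have hsum := Finset.sum_le_sum fun z (_ : z ∈ Finset.univ) => hpt z
  simp only [Finset.sum_add_distrib, ← Finset.mul_sum] at hsum
  have g1 := mul_le_mul_of_nonneg_left h1 (inv_nonneg.2 hn0.le)
  have g2 := mul_le_mul_of_nonneg_left h2 (inv_nonneg.2 hn0.le)
  have g3 := mul_le_mul_of_nonneg_left h3 (sq_nonneg n)
  have g4 : n⁻¹ * (104 * n ^ 5) = 104 * n ^ 4 := by field_simp
  rw [g4] at g1 g2
  have : 0 ≤ n ^ 4 := by positivity
  nlinarith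

/-- The L² function at the third vertex is paired with the triangle operator applied to the other
two; the tail contributes a degree. -/
lemma mem_kiteExponents_triangle (h : SparseKernel e n) :
    ![1 / 2, 1 / 2, 1 / 2, 0] ∈ kiteExponents e n 424 := by
  intro F hF1 hF
  have hn := h.one_le
  have hn0 : 0 < n := by linarith
  have h0 : ∀ j x, 0 ≤ F j x := fun j x => zero_le_one.trans (hF1 j x)
  have hr0 : ∀ j x, 0 ≤ F j x ^ (1 / 2 : ℝ) := fun j x => Real.rpow_nonneg (h0 j x) _
  simp only [Matrix.cons_val, Real.rpow_zero]
  refine (h.kiteSum_one_right_le (hr0 0) (hr0 1) (hr0 2)).trans ?_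
  have h1 := h.sum_triangle_sq_le (fun x => F 0 x ^ (1 / 2 : ℝ)) (fun x => F 1 x ^ (1 / 2 : ℝ))
  simp only [rpow_half_sq (hF1 _ _)] at h1
  have hA := hF 0
  have hB := hF 1
  have hA0 : 0 ≤ ∑ x, F 0 x := Finset.sum_nonneg fun x _ => h0 0 x
  have hB0 : 0 ≤ ∑ x, F 1 x := Finset.sum_nonneg fun x _ => h0 1 x
  have h2 : ∑ z, (∑ x, ∑ w, triangle e z x w *
      (F 0 x ^ (1 / 2 : ℝ) * F 1 w ^ (1 / 2 : ℝ))) ^ 2 ≤ 128 * n ^ 4 := by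
    refine h1.trans ?_
    have e1 := pow_le_pow_left₀ hA0 hA 2
    have e2 := pow_le_pow_left₀ hB0 hB 2
    have e3 := mul_le_mul hA hB hB0 (by positivity)
    nlinarith
  have hpt : ∀ z, F 2 z ^ (1 / 2 : ℝ) * ∑ x, ∑ w, triangle e z x w *
      (F 0 x ^ (1 / 2 : ℝ) * F 1 w ^ (1 / 2 : ℝ)) ≤ n * F 2 z + n⁻¹ *
      (∑ x, ∑ w, triangle e z x w * (F 0 x ^ (1 / 2 : ℝ) * F 1 w ^ (1 / 2 : ℝ))) ^ 2 := by
    intro z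
    have hsq := rpow_half_sq (hF1 2 z)
    set p := F 2 z ^ (1 / 2 : ℝ)
    have hs : 0 ≤ ∑ x, ∑ w, triangle e z x w * (F 0 x ^ (1 / 2 : ℝ) * F 1 w ^ (1 / 2 : ℝ)) :=
      Finset.sum_nonneg fun x _ => Finset.sum_nonneg fun w _ =>
        mul_nonneg (h.triangle_nonneg _ _ _) (mul_nonneg (hr0 _ _) (hr0 _ _))
    set S := ∑ x, ∑ w, triangle e z x w * (F 0 x ^ (1 / 2 : ℝ) * F 1 w ^ (1 / 2 : ℝ))
    have hS : S = n * (S / n) := by field_simp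
    set T := S / n
    rw [← hsq, hS]
    calc _ = n * (p * T) := by ring
      _ ≤ n * (p ^ 2 + T ^ 2) := by
        refine mul_le_mul_of_nonneg_left ?_ hn0.le
        nlinarith [sq_nonneg (p - T), sq_nonneg p, sq_nonneg T]
      _ = _ := by field_simp
  have hsum := Finset.sum_le_sum fun z (_ : z ∈ Finset.univ) => hpt z
  simp only [Finset.sum_add_distrib, ← Finset.mul_sum] at hsum
  have g1 := mul_le_mul_of_nonneg_left h2 (inv_nonneg.2 hn0.le)
  have g2 := mul_le_mul_of_nonneg_left (hF 2) hn0.le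
  have g4 : n⁻¹ * (128 * n ^ 4) = 128 * n ^ 3 := by field_simp
  rw [g4] at g1
  have g5 := mul_le_mul_of_nonneg_left (hsum.trans (add_le_add g2 g1))
    (show 0 ≤ 2 * n by linarith)
  have : 0 ≤ n ^ 4 := by positivity
  nlinarith

end SparseKernel

/-! ### Convex geometry of the exponent polytope. -/

/-- For sorted coordinates, summation by parts writes the point with weights x − y, 3(y − z)/2, 2z
on the three nonzero vertices; the constraint says exactly that the weight left for 0 is
nonnegative. -/
lemma combination_mem_of_sorted {E : Type*} [AddCommGroup E] [Module ℝ E] {G : Set E}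
    (hG : Convex ℝ G) {u v w : E} (h0 : (0 : E) ∈ G) (hu : u ∈ G)
    (huv : (2 / 3 : ℝ) • (u + v) ∈ G) (huvw : (1 / 2 : ℝ) • (u + v + w) ∈ G) {x y z : ℝ}
    (hz : 0 ≤ z) (hzy : z ≤ y) (hyx : y ≤ x) (hx : 2 * x + y + z ≤ 2) :
    x • u + y • v + z • w ∈ G := by
  have key := hG.sum_mem (t := Finset.univ) (w := ![x - y, 3 / 2 * (y - z), 2 * z,
    1 - x - y / 2 - z / 2]) (z := ![u, (2 / 3 : ℝ) • (u + v), (1 / 2 : ℝ) • (u + v + w), 0])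
    (by intro i _; fin_cases i <;> simp <;> linarith)
    (by simp [Fin.sum_univ_four]; ring)
    (by intro i _; fin_cases i; exacts [hu, huv, huvw, h0])
  simp only [Fin.sum_univ_four, Matrix.cons_val] at key
  convert key using 1
  module

/-- The convex hull of `0`, `e_i`, `2/3 (e_i + e_j)` and `1/2 (e₁ + e₂ + e₃)`. -/
lemma combination_mem {E : Type*} [AddCommGroup E] [Module ℝ E] {G : Set E}
    (hG : Convex ℝ G) {u v w : E} (h0 : (0 : E) ∈ G) (hu : u ∈ G) (hv : v ∈ G) (hw : w ∈ G)
    (huv : (2 / 3 : ℝ) • (u + v) ∈ G) (huw : (2 / 3 : ℝ) • (u + w) ∈ G)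
    (hvw : (2 / 3 : ℝ) • (v + w) ∈ G) (huvw : (1 / 2 : ℝ) • (u + v + w) ∈ G) {x y z : ℝ}
    (hx : 0 ≤ x) (hy : 0 ≤ y) (hz : 0 ≤ z) (h₁ : 2 * x + y + z ≤ 2) (h₂ : x + 2 * y + z ≤ 2)
    (h₃ : x + y + 2 * z ≤ 2) : x • u + y • v + z • w ∈ G := by
  have hvu : (2 / 3 : ℝ) • (v + u) ∈ G := by rwa [add_comm]
  have hwu : (2 / 3 : ℝ) • (w + u) ∈ G := by rwa [add_comm]
  have hwv : (2 / 3 : ℝ) • (w + v) ∈ G := by rwa [add_comm]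
  have c1 : (1 / 2 : ℝ) • (u + w + v) ∈ G := by convert huvw using 2; abel
  have c2 : (1 / 2 : ℝ) • (v + u + w) ∈ G := by convert huvw using 2; abel
  have c3 : (1 / 2 : ℝ) • (v + w + u) ∈ G := by convert huvw using 2; abel
  have c4 : (1 / 2 : ℝ) • (w + u + v) ∈ G := by convert huvw using 2; abel
  have c5 : (1 / 2 : ℝ) • (w + v + u) ∈ G := by convert huvw using 2; abel
  rcases le_total x y with hxy | hxy <;> rcases le_total y z with hyz | hyz <;>
    rcases le_total x z with hxz | hxz
  · convert combination_mem_of_sorted hG h0 hw hwv c5 hx hxy hyz (by linarith) using 1; abel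
  · convert combination_mem_of_sorted hG h0 hw hwv c5 hx hxy hyz (by linarith) using 1; abel
  · convert combination_mem_of_sorted hG h0 hv hvw c3 hx hxz hyz (by linarith) using 1; abel
  · convert combination_mem_of_sorted hG h0 hv hvu c2 hz hxz hxy (by linarith) using 1; abel
  · convert combination_mem_of_sorted hG h0 hw hwu c4 hy hxy hxz (by linarith) using 1; abel
  · convert combination_mem_of_sorted hG h0 hu huw c1 hy hyz hxz (by linarith) using 1; abel
  · convert combination_mem_of_sorted hG h0 hu huv huvw hz hyz hxy (by linarith) using 1
  · convert combination_mem_of_sorted hG h0 hu huv huvw hz hyz hxy (by linarith) using 1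

/-- All exponents in the polytope cut out by the necessary conditions for the diamond are
admissible for the kite. -/
theorem SparseKernel.mem_kiteExponents {V : Type*} [Fintype V] {e : V → V → ℝ} {n : ℝ}
    (h : SparseKernel e n) {a : Fin 4 → ℝ} (ha : ∀ j, 0 ≤ a j)
    (h₁ : 2 * a 0 + a 1 + a 2 + a 3 ≤ 2) (h₂ : a 0 + a 1 + 2 * a 2 + a 3 ≤ 2)
    (h₃ : a 0 + 2 * a 1 + a 2 + 2 * a 3 ≤ 2) : a ∈ kiteExponents e n 424 := by
  have hG := h.kiteExponents_convex 424
  have v1 := h.mem_kiteExponents_first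
  have v2 := h.kiteExponents_swap v1
  have v3 := h.mem_kiteExponents_third
  have v4 := h.mem_kiteExponents_fourth
  have v0 : (0 : Fin 4 → ℝ) ∈ kiteExponents e n 424 :=
    h.kiteExponents_of_le v1 (by intro j; fin_cases j <;> simp)
  have v12 := h.mem_kiteExponents_first_second
  have v13 := h.mem_kiteExponents_first_third
  have v23 := h.kiteExponents_swap v13
  have v34 := h.mem_kiteExponents_third_fourth
  have vH := h.mem_kiteExponents_hinge
  have v123 := h.mem_kiteExponents_triangle
  have v14 : ![2 / 3, 0, 0, 2 / 3] ∈ kiteExponents e n 424 :=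
    h.kiteExponents_of_le vH (by intro j; fin_cases j <;> simp)
  -- Three quarters of the hinge vertex plus one quarter of the third unit vector.
  have v134 : ![1 / 2, 0, 1 / 2, 1 / 2] ∈ kiteExponents e n 424 := by
    have := hG vH v3 (show (0 : ℝ) ≤ 3 / 4 by norm_num) (show (0 : ℝ) ≤ 1 / 4 by norm_num)
      (by norm_num)
    convert this using 1
    ext j; fin_cases j <;> norm_num
  -- All three constraints see only the first and third exponents and s. Hence s may be placed
  -- wholly on the second or wholly on the fourth vertex, and a is the mixture with weights a₂/s and
  -- a₄/s.
  set s := a 1 + a 3 with hs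
  have hs0 : 0 ≤ s := add_nonneg (ha 1) (ha 3)
  have hT : ![a 0, s, a 2, 0] ∈ kiteExponents e n 424 := by
    have := combination_mem hG (u := ![1, 0, 0, 0]) (v := ![0, 1, 0, 0]) (w := ![0, 0, 1, 0])
      v0 v1 v2 v3 (by simpa using v12) (by simpa using v13) (by simpa using v23)
      (by simpa using v123) (ha 0) hs0 (ha 2) (by linarith) (by linarith) (by linarith)
    simpa using this
  have hH : ![a 0, 0, a 2, s] ∈ kiteExponents e n 424 := by
    have := combination_mem hG (u := ![1, 0, 0, 0]) (v := ![0, 0, 0, 1]) (w := ![0, 0, 1, 0])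
      v0 v1 v4 v3 (by simpa using v14) (by simpa using v13) (by simpa using v34)
      (by simpa using v134) (ha 0) hs0 (ha 2) (by linarith) (by linarith) (by linarith)
    simpa using this
  rcases hs0.eq_or_lt with hz | hpos
  · refine h.kiteExponents_of_le hT ?_
    have e1 : a 3 ≤ 0 := by linarith [ha 1]
    have e2 : a 1 ≤ s := by linarith [ha 3]
    intro j; fin_cases j <;> simp [e1, e2]
  · have hsum : a 1 / s + a 3 / s = 1 := by rw [← add_div, ← hs, div_self hpos.ne']
    have := hG hT hH (div_nonneg (ha 1) hs0) (div_nonneg (ha 3) hs0) hsum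
    convert this using 1
    ext j
    fin_cases j
    · simp [← add_mul, hsum]
    · simp [div_mul_cancel₀ _ hpos.ne']
    · simp [← add_mul, hsum]
    · simp [div_mul_cancel₀ _ hpos.ne']

/-! ### Circles over finite fields: intersections, triangles and cardinality. -/

lemma mem_circle {F : Type*} [Field F] {t : F} {x : Plane F} :
    x ∈ circle t ↔ x 0 ^ 2 + x 1 ^ 2 = t := Iff.rfl

lemma circleInd_nonneg {F : Type*} [Field F] (t : F) (x : Plane F) : 0 ≤ circleInd t x :=
  Set.indicator_nonneg (fun _ _ => zero_le_one) x

lemma circleInd_le_one {F : Type*} [Field F] (t : F) (x : Plane F) : circleInd t x ≤ 1 :=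
  Set.indicator_le_self' (fun _ _ => zero_le_one) x

lemma circleInd_of_mem {F : Type*} [Field F] {t : F} {x : Plane F} (hx : x ∈ circle t) :
    circleInd t x = 1 := Set.indicator_of_mem hx _

lemma circleInd_of_notMem {F : Type*} [Field F] {t : F} {x : Plane F} (hx : x ∉ circle t) :
    circleInd t x = 0 := Set.indicator_of_notMem hx _

lemma circleInd_neg {F : Type*} [Field F] (t : F) (x : Plane F) :
    circleInd t (-x) = circleInd t x := by
  have : -x ∈ circle t ↔ x ∈ circle t := by simp [mem_circle]
  by_cases hx : x ∈ circle t
  · rw [circleInd_of_mem hx, circleInd_of_mem (this.2 hx)]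
  · rw [circleInd_of_notMem hx, circleInd_of_notMem (this.not.2 hx)]

lemma circleInd_sub_comm {F : Type*} [Field F] (t : F) (x y : Plane F) :
    circleInd t (x - y) = circleInd t (y - x) := by
  rw [← neg_sub, circleInd_neg]

lemma neg_mem_circle {F : Type*} [Field F] {t : F} {x : Plane F} (hx : x ∈ circle t) :
    -x ∈ circle t := by simpa [mem_circle] using hx

/-- Two points of the intersection of two distinct circles of the same radius are equal or
exchanged by the half turn about the midpoint of the centres. -/
lemma eq_or_add_eq_of_mem_circle {F : Type*} [Field F] (h2 : (2 : F) ≠ 0) {t : F} (ht : t ≠ 0)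
    {d u v : Plane F} (hd : d ≠ 0) (hu : u ∈ circle t) (hv : v ∈ circle t)
    (hud : u - d ∈ circle t) (hvd : v - d ∈ circle t) : v = u ∨ v = d - u := by
  simp only [mem_circle, Pi.sub_apply] at hu hv hud hvd
  have e1 : 2 * (u 0 * d 0 + u 1 * d 1) = d 0 ^ 2 + d 1 ^ 2 := by linear_combination hu - hud
  have e2 : 2 * (v 0 * d 0 + v 1 * d 1) = d 0 ^ 2 + d 1 ^ 2 := by linear_combination hv - hvd
  have hd' : d 0 ≠ 0 ∨ d 1 ≠ 0 := by
    by_contra! hc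
    exact hd (by ext j; fin_cases j; exacts [hc.1, hc.2])
  -- An isotropic d would be orthogonal to u, which forces u to be isotropic too, contradicting t ≠
  -- 0.
  have hD : d 0 ^ 2 + d 1 ^ 2 ≠ 0 := by
    intro hD
    have e3 : u 0 * d 0 + u 1 * d 1 = 0 := by
      rw [hD] at e1; exact (mul_eq_zero.1 e1).resolve_left h2
    rcases hd' with h | h
    · have : d 0 ^ 2 * t = 0 := by
        linear_combination -(d 0 ^ 2) * hu + u 1 ^ 2 * hD + (u 0 * d 0 - u 1 * d 1) * e3
      exact (mul_ne_zero (pow_ne_zero 2 h) ht) this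
    · have : d 1 ^ 2 * t = 0 := by
        linear_combination -(d 1 ^ 2) * hu + u 0 ^ 2 * hD + (u 1 * d 1 - u 0 * d 0) * e3
      exact (mul_ne_zero (pow_ne_zero 2 h) ht) this
  -- Both v − u and v + u − d are orthogonal to d and to each other. Since d is not isotropic, its
  -- orthogonal complement is an anisotropic line, so one of them vanishes; the products of
  -- coordinates below carry this out.
  have m : (v 0 - u 0) * d 0 + (v 1 - u 1) * d 1 = 0 := by
    refine (mul_eq_zero.1 (?_ : (2 : F) * _ = 0)).resolve_left h2
    linear_combination e2 - e1
  have k : (v 0 + u 0 - d 0) * d 0 + (v 1 + u 1 - d 1) * d 1 = 0 := by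
    refine (mul_eq_zero.1 (?_ : (2 : F) * _ = 0)).resolve_left h2
    linear_combination e2 + e1
  have mk : (v 0 - u 0) * (v 0 + u 0 - d 0) + (v 1 - u 1) * (v 1 + u 1 - d 1) = 0 := by
    linear_combination hv - hu - m
  generalize hm0 : v 0 - u 0 = m0 at *
  generalize hm1 : v 1 - u 1 = m1 at *
  generalize hk0 : v 0 + u 0 - d 0 = k0 at *
  generalize hk1 : v 1 + u 1 - d 1 = k1 at *
  have p11 : m1 * k1 = 0 := by
    refine (mul_eq_zero.1 (?_ : _ * (d 0 ^ 2 + d 1 ^ 2) = 0)).resolve_right hD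
    linear_combination d 0 ^ 2 * mk - k0 * d 0 * m + m1 * d 1 * k
  have p00 : m0 * k0 = 0 := by linear_combination mk - p11
  have p01 : m0 * k1 = 0 := by
    refine (mul_eq_zero.1 (?_ : _ * (d 0 ^ 2 + d 1 ^ 2) = 0)).resolve_right hD
    linear_combination k1 * d 0 * m - d 0 * d 1 * p11 + m0 * d 1 * k - d 0 * d 1 * p00
  have p10 : m1 * k0 = 0 := by
    refine (mul_eq_zero.1 (?_ : _ * (d 0 ^ 2 + d 1 ^ 2) = 0)).resolve_right hD
    linear_combination m1 * d 0 * k - d 0 * d 1 * p11 + k0 * d 1 * m - d 0 * d 1 * p00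
  by_cases hm : m0 = 0 ∧ m1 = 0
  · left
    ext j
    fin_cases j
    · exact sub_eq_zero.1 (hm0.trans hm.1)
    · exact sub_eq_zero.1 (hm1.trans hm.2)
  · right
    have hk : k0 = 0 ∧ k1 = 0 := by
      by_cases h : m0 = 0
      · have h' : m1 ≠ 0 := fun h' => hm ⟨h, h'⟩
        exact ⟨(mul_eq_zero.1 p10).resolve_left h', (mul_eq_zero.1 p11).resolve_left h'⟩
      · exact ⟨(mul_eq_zero.1 p00).resolve_left h, (mul_eq_zero.1 p01).resolve_left h⟩
    ext j
    fin_cases j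
    · simp only [Fin.zero_eta, Pi.sub_apply]; linear_combination hk0.trans hk.1
    · simp only [Fin.mk_one, Pi.sub_apply]; linear_combination hk1.trans hk.2

/-- A point `y` of the circle completes the segment from `0` to `y` to an equilateral triangle. -/
lemma exists_mem_circle_sub_mem {F : Type*} [Field F] (h2 : (2 : F) ≠ 0) (h3 : IsSquare (3 : F))
    {t : F} {y : Plane F} (hy : y ∈ circle t) : ∃ x ∈ circle t, y - x ∈ circle t := by
  obtain ⟨r, hr⟩ := h3
  simp only [mem_circle] at hy
  -- The rotation of y by 60 degrees, with r a square root of 3.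
  refine ⟨![(y 0 - r * y 1) / 2, (y 1 + r * y 0) / 2], ?_, ?_⟩
  · simp only [mem_circle, Matrix.cons_val]
    field_simp
    linear_combination (4 : F) * hy - (y 0 ^ 2 + y 1 ^ 2) * hr
  · simp only [mem_circle, Pi.sub_apply, Matrix.cons_val]
    field_simp
    linear_combination (4 : F) * hy - (y 0 ^ 2 + y 1 ^ 2) * hr

section Finite

variable {F : Type*} [Field F] [Fintype F]

lemma two_ne_zero_of_odd_card (hodd : Odd (Fintype.card F)) : (2 : F) ≠ 0 := by
  refine Ring.two_ne_zero fun h => ?_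
  have := FiniteField.even_card_of_char_two h
  rw [Nat.odd_iff] at hodd
  omega

lemma three_le_card (hodd : Odd (Fintype.card F)) : 3 ≤ Fintype.card F := by
  have := Fintype.one_lt_card (α := F)
  obtain ⟨k, hk⟩ := hodd
  omega

lemma card_plane {K : Type*} [Fintype K] :
    (Fintype.card (Plane K) : ℝ) = (Fintype.card K : ℝ) ^ 2 := by
  simp [Plane]

lemma sum_circleInd (t : F) : ∑ x, circleInd t x = ((circle t).ncard : ℝ) := by
  classical
  rw [Set.ncard_eq_toFinset_card']
  simp only [circleInd, Set.indicator_apply, Pi.one_apply, Finset.sum_boole]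
  congr 2
  ext x
  simp

lemma sum_circleInd_sub (t : F) (x : Plane F) :
    ∑ y, circleInd t (x - y) = ((circle t).ncard : ℝ) := by
  rw [← sum_circleInd]
  exact (Equiv.subLeft x).sum_comp (circleInd t)

lemma exists_mem_circle (hodd : Odd (Fintype.card F)) (t : F) : ∃ x, x ∈ circle t := by
  open Polynomial in
  obtain ⟨a, b, hab⟩ := FiniteField.exists_root_sum_quadratic (R := F) (f := X ^ 2)
    (g := X ^ 2 - C t) (by simp) (degree_X_pow_sub_C (by norm_num) t) (Nat.odd_iff.1 hodd)
  refine ⟨![a, b], ?_⟩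
  simp at hab
  simp only [mem_circle, Matrix.cons_val]
  linear_combination hab

lemma ncard_circle_le (t : F) : (circle t).ncard ≤ 2 * Fintype.card F := by
  classical
  rw [Set.ncard_eq_toFinset_card']
  refine (Finset.card_le_mul_card_image (f := fun x : Plane F => x 0) _ 2 ?_).trans
    (Nat.mul_le_mul_left 2 (Finset.card_le_univ _))
  intro c hc
  obtain ⟨z, hz, rfl⟩ := Finset.mem_image.1 hc
  refine (Finset.card_le_card (?_ : _ ⊆ ({z, ![z 0, -z 1]} : Finset (Plane F)))).trans
    Finset.card_le_two
  intro x hx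
  simp only [Finset.mem_filter, Set.mem_toFinset, mem_circle] at hx hz
  have h1 : x 1 ^ 2 = z 1 ^ 2 := by
    have := hx.1; rw [hx.2] at this; linear_combination this - hz
  simp only [Finset.mem_insert, Finset.mem_singleton]
  rcases sq_eq_sq_iff_eq_or_eq_neg.1 h1 with h | h
  · left; ext j; fin_cases j; exacts [hx.2, h]
  · right; ext j; fin_cases j
    · exact hx.2
    · simpa using h

/-- Lines through a point of the circle meet it in a second point. -/
lemma card_le_ncard_circle_add_two (hodd : Odd (Fintype.card F)) {t : F} (ht : t ≠ 0) :
    Fintype.card F ≤ (circle t).ncard + 2 := by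
  classical
  have h2 := two_ne_zero_of_odd_card hodd
  obtain ⟨p, hp⟩ := exists_mem_circle hodd t
  have hp' := hp
  simp only [mem_circle] at hp'
  let A : Finset F := Finset.univ.filter fun m => 1 + m ^ 2 ≠ 0
  -- The parameter of the second intersection with the line of slope m through p. Slopes with 1 + m²
  -- = 0, at most two, are discarded.
  let s : F → F := fun m => -2 * (p 0 + m * p 1) / (1 + m ^ 2)
  have hA : Fintype.card F ≤ A.card + 2 := by
    have h1 := Finset.card_filter_add_card_filter_not (s := (Finset.univ : Finset F))
      (fun m => 1 + m ^ 2 ≠ 0)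
    have h3 : (Finset.univ.filter fun m : F => ¬ (1 + m ^ 2 ≠ 0)).card ≤ 2 := by
      by_cases hex : ∃ m : F, 1 + m ^ 2 = 0
      · obtain ⟨m, hm⟩ := hex
        refine (Finset.card_le_card (?_ : _ ⊆ ({m, -m} : Finset F))).trans Finset.card_le_two
        intro x hx
        simp only [Finset.mem_filter, not_not] at hx
        have h1 : x ^ 2 = m ^ 2 := by linear_combination hx.2 - hm
        simpa using sq_eq_sq_iff_eq_or_eq_neg.1 h1
      · push Not at hex
        rw [Finset.filter_false_of_mem (by simpa using hex)]
        simp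
    rw [Finset.card_univ] at h1
    change A.card + _ = _ at h1
    omega
  have hB : A.card ≤ (circle t).toFinset.card := by
    refine Finset.card_le_card_of_injOn (fun m => ![p 0 + s m, p 1 + m * s m]) ?_ ?_
    · intro m hm
      have hm' : 1 + m ^ 2 ≠ 0 := by simpa [A] using hm
      have hs : s m * (1 + m ^ 2) = -2 * (p 0 + m * p 1) := div_mul_cancel₀ _ hm'
      simp only [Set.coe_toFinset, mem_circle, Matrix.cons_val]
      linear_combination hp' + s m * hs
    · intro m hm l hl hml
      have hm' : 1 + m ^ 2 ≠ 0 := by simpa [A] using hm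
      have hl' : 1 + l ^ 2 ≠ 0 := by simpa [A] using hl
      have hsm : s m * (1 + m ^ 2) = -2 * (p 0 + m * p 1) := div_mul_cancel₀ _ hm'
      have hsl : s l * (1 + l ^ 2) = -2 * (p 0 + l * p 1) := div_mul_cancel₀ _ hl'
      have e0 := congrFun hml 0
      have e1 := congrFun hml 1
      simp only [Matrix.cons_val, add_right_inj] at e0 e1
      rw [← e0] at e1 hsl
      -- Vanishing of the parameter means tangency at p, and p has only one tangent slope; otherwise
      -- the slope is read off from the second point.
      by_cases hs : s m = 0
      · rw [hs] at hsm hsl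
        have c1 : p 0 + m * p 1 = 0 := by
          refine (mul_eq_zero.1 (?_ : (2 : F) * _ = 0)).resolve_left h2
          linear_combination hsm
        have c2 : p 0 + l * p 1 = 0 := by
          refine (mul_eq_zero.1 (?_ : (2 : F) * _ = 0)).resolve_left h2
          linear_combination hsl
        have c3 : (m - l) * p 1 = 0 := by linear_combination c1 - c2
        rcases mul_eq_zero.1 c3 with h | h
        · exact sub_eq_zero.1 h
        · rw [h, mul_zero, add_zero] at c1
          rw [h, c1] at hp'
          exact absurd hp'.symm (by simpa using ht)
      · exact mul_right_cancel₀ hs e1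
  rw [Set.ncard_eq_toFinset_card']
  omega

lemma card_le_three_mul_ncard_circle (hodd : Odd (Fintype.card F)) {t : F} (ht : t ≠ 0) :
    Fintype.card F ≤ 3 * (circle t).ncard := by
  have h1 := card_le_ncard_circle_add_two hodd ht
  have h2 := three_le_card hodd
  omega

lemma sum_circleInd_mul_le (hodd : Odd (Fintype.card F)) {t : F} (ht : t ≠ 0) {x y : Plane F}
    (hxy : x ≠ y) : ∑ z, circleInd t (x - z) * circleInd t (y - z) ≤ 2 := by
  classical
  have h2 := two_ne_zero_of_odd_card hodd
  by_cases hex : ∃ z, x - z ∈ circle t ∧ y - z ∈ circle t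
  · obtain ⟨z₀, hx₀, hy₀⟩ := hex
    -- The second common neighbour is the reflection of the first in the midpoint of x and y.
    have h1 : ∀ z ∉ ({z₀, x + y - z₀} : Finset (Plane F)),
        circleInd t (x - z) * circleInd t (y - z) = 0 := by
      intro z hz
      by_contra hne
      have hx : x - z ∈ circle t := by
        by_contra hc; exact hne (by rw [circleInd_of_notMem hc, zero_mul])
      have hy : y - z ∈ circle t := by
        by_contra hc; exact hne (by rw [circleInd_of_notMem hc, mul_zero])
      have := eq_or_add_eq_of_mem_circle h2 ht (sub_ne_zero.2 hxy) hx₀ hx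
        (by rwa [show x - z₀ - (x - y) = y - z₀ by abel])
        (by rwa [show x - z - (x - y) = y - z by abel])
      apply hz
      simp only [Finset.mem_insert, Finset.mem_singleton]
      rcases this with h | h
      · left; exact sub_right_inj.1 h
      · right
        have : x - (x - z) = x - (x - y - (x - z₀)) := by rw [h]
        rw [sub_sub_cancel] at this
        rw [this]; abel
    rw [← Finset.sum_subset (Finset.subset_univ ({z₀, x + y - z₀} : Finset (Plane F)))
      fun z _ hz => h1 z hz]
    calc _ ≤ ∑ z ∈ ({z₀, x + y - z₀} : Finset (Plane F)), (1 : ℝ) := by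
          refine Finset.sum_le_sum fun z _ => ?_
          exact mul_le_one₀ (circleInd_le_one _ _) (circleInd_nonneg _ _) (circleInd_le_one _ _)
      _ ≤ 2 := by
          rw [Finset.sum_const, nsmul_eq_mul, mul_one]
          exact_mod_cast Finset.card_le_two
  · push Not at hex
    rw [Finset.sum_eq_zero]
    · norm_num
    · intro z _
      by_cases hx : x - z ∈ circle t
      · rw [circleInd_of_notMem (hex z hx), mul_zero]
      · rw [circleInd_of_notMem hx, zero_mul]

lemma sparseKernel_circleInd (hodd : Odd (Fintype.card F)) {t : F} (ht : t ≠ 0) :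
    SparseKernel (fun x y => circleInd t (x - y)) (Fintype.card F) where
  nonneg _ _ := circleInd_nonneg _ _
  le_one _ _ := circleInd_le_one _ _
  symm := circleInd_sub_comm t
  self x := by
    rw [sub_self]
    exact circleInd_of_notMem (by simpa [mem_circle] using ht.symm)
  degree x := by
    rw [sum_circleInd_sub]
    exact_mod_cast ncard_circle_le t
  codegree _ _ := sum_circleInd_mul_le hodd ht
  one_le := by exact_mod_cast Fintype.card_pos
  card := card_plane

end Finite

/-! ### From exponents to strong-type bounds. -/

/-- A non-negative function is dominated by a power of a function of mean at most `2`. -/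
lemma exists_dominating {F : Type*} [Field F] [Fintype F] {p : ℝ≥0∞} (hp : 1 ≤ p)
    (f : Plane F → ℝ) (hf : ∀ x, 0 ≤ f x) :
    ∃ g : Plane F → ℝ, (∀ x, 1 ≤ g x) ∧ ∑ x, g x ≤ 2 * (Fintype.card F : ℝ) ^ 2 ∧
      ∀ x, f x ≤ normL p f * g x ^ (p⁻¹).toReal := by
  have hq : (0 : ℝ) < (Fintype.card F : ℝ) ^ 2 := by
    have : (0 : ℝ) < Fintype.card F := by exact_mod_cast Fintype.card_pos
    positivity
  have hone : ∑ _x : Plane F, (1 : ℝ) = (Fintype.card F : ℝ) ^ 2 := by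
    rw [Finset.sum_const, nsmul_eq_mul, mul_one, Finset.card_univ, card_plane]
  by_cases hp' : p = ∞
  · refine ⟨fun _ => 1, fun _ => le_rfl, ?_, fun x => ?_⟩
    · rw [hone]; linarith
    · rw [Real.one_rpow, mul_one, normL, if_pos hp']
      exact (le_abs_self _).trans (le_ciSup (f := fun x => |f x|) (Set.finite_range _).bddAbove x)
  · have hr : 1 ≤ p.toReal := by
      simpa using ENNReal.toReal_mono hp' hp
    have hr0 : 0 < p.toReal := by linarith
    set r := p.toReal with hrdef
    have hfr : ∀ x, 0 ≤ f x ^ r := fun x => Real.rpow_nonneg (hf x) r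
    set M := ((Fintype.card F : ℝ) ^ 2)⁻¹ * ∑ x, f x ^ r with hM
    have hM0 : 0 ≤ M := mul_nonneg (inv_nonneg.2 hq.le) (Finset.sum_nonneg fun x _ => hfr x)
    have hN : normL p f = M ^ (1 / r) := by
      simp only [normL, if_neg hp', abs_of_nonneg (hf _), ← hrdef, hM]
    have hsum : ∑ x, f x ^ r = (Fintype.card F : ℝ) ^ 2 * M := by
      rw [hM, mul_inv_cancel_left₀ hq.ne']
    -- The second summand has mean 1, or is zero by the convention for division by 0 when M = 0, in
    -- which case f vanishes.
    refine ⟨fun x => 1 + f x ^ r / M, fun x => ?_, ?_, fun x => ?_⟩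
    · have := div_nonneg (hfr x) hM0
      linarith
    · rw [Finset.sum_add_distrib, hone, ← Finset.sum_div, hsum]
      have : (Fintype.card F : ℝ) ^ 2 * M / M ≤ (Fintype.card F : ℝ) ^ 2 :=
        div_le_of_le_mul₀ hM0 hq.le le_rfl
      linarith
    · rw [hN, ENNReal.toReal_inv, ← hrdef, one_div]
      rcases hM0.eq_or_lt with h0 | hpos
      · have h1 : f x ^ r ≤ 0 := by
          rw [← h0, mul_zero] at hsum
          rw [← hsum]
          exact Finset.single_le_sum (fun y _ => hfr y) (Finset.mem_univ x)
        have h2 : f x = 0 := by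
          have h3 := le_antisymm h1 (hfr x)
          exact (Real.rpow_eq_zero (hf x) hr0.ne').1 h3
        rw [h2, ← h0, Real.zero_rpow (inv_ne_zero hr0.ne'), zero_mul]
      · have hnn : 0 ≤ 1 + f x ^ r / M := by
          have := div_nonneg (hfr x) hM0
          linarith
        rw [← Real.mul_rpow hM0 hnn]
        calc f x = (f x ^ r) ^ r⁻¹ := (Real.rpow_rpow_inv (hf x) hr0.ne').symm
          _ ≤ _ := by
            refine Real.rpow_le_rpow (hfr x) ?_ (inv_nonneg.2 hr0.le)
            rw [mul_add, mul_one, mul_div_cancel₀ _ hpos.ne']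
            linarith

section

variable {F : Type*} [Field F] [Fintype F] {t : F}

lemma kiteForm_eq (t : F) (f : Fin 4 → Plane F → ℝ) :
    kiteForm t f = 1 / ((Fintype.card F : ℝ) ^ 2 * ((circle t).ncard : ℝ) ^ 2) *
      kiteSum (fun x y => circleInd t (x - y)) (f 0) (f 1) (f 2) (f 3) := rfl

lemma kiteSum_mul {V : Type*} [Fintype V] (e : V → V → ℝ) (a b c d : ℝ) (f₁ f₂ f₃ f₄ : V → ℝ) :
    kiteSum e (fun x => a * f₁ x) (fun x => b * f₂ x) (fun x => c * f₃ x) (fun x => d * f₄ x) =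
      a * b * c * d * kiteSum e f₁ f₂ f₃ f₄ := by
  simp only [kiteSum, Finset.mul_sum]
  exact Finset.sum_congr rfl fun x _ => Finset.sum_congr rfl fun y _ =>
    Finset.sum_congr rfl fun z _ => Finset.sum_congr rfl fun w _ => by ring

/-- The factor 9 compares q⁴ with the normalization q²|S_t|², using q ≤ 3|S_t|. -/
lemma strongBound_of_mem_kiteExponents (hodd : Odd (Fintype.card F)) (ht : t ≠ 0)
    {p : Fin 4 → ℝ≥0∞} (hp : ∀ j, 1 ≤ p j) {C : ℝ≥0}
    (hC : (fun j => ((p j)⁻¹).toReal) ∈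
      kiteExponents (fun x y => circleInd t (x - y)) (Fintype.card F) C) :
    StrongBound (kiteForm t) p (9 * C) := by
  intro f hf
  have h := sparseKernel_circleInd hodd ht
  choose g hg1 hg hfg using fun j => exists_dominating (hp j) (f j) (hf j)
  have h1 := hC g hg1 hg
  have h2 := h.kiteSum_mono (hf 0) (hf 1) (hf 2) (hf 3) (hfg 0) (hfg 1) (hfg 2) (hfg 3)
  rw [kiteSum_mul] at h2
  have hN := fun j => normL_nonneg (p j) (f j)
  have hP : 0 ≤ normL (p 0) (f 0) * normL (p 1) (f 1) * normL (p 2) (f 2) * normL (p 3) (f 3) :=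
    mul_nonneg (mul_nonneg (mul_nonneg (hN 0) (hN 1)) (hN 2)) (hN 3)
  have h3 := h2.trans (mul_le_mul_of_nonneg_left h1 hP)
  rw [kiteForm_eq, Fin.prod_univ_four]
  set P := normL (p 0) (f 0) * normL (p 1) (f 1) * normL (p 2) (f 2) * normL (p 3) (f 3)
  have hq : (0 : ℝ) < Fintype.card F := by exact_mod_cast Fintype.card_pos
  have hN3 : (Fintype.card F : ℝ) ≤ 3 * (circle t).ncard := by
    exact_mod_cast card_le_three_mul_ncard_circle hodd ht
  set q : ℝ := (Fintype.card F : ℝ)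
  set N : ℝ := ((circle t).ncard : ℝ)
  have hNpos : 0 < N := by linarith
  rw [one_div, inv_mul_le_iff₀ (by positivity)]
  refine h3.trans ?_
  have h4 : q ^ 2 ≤ 9 * N ^ 2 := by nlinarith
  have hC0 : (0 : ℝ) ≤ C := C.coe_nonneg
  push_cast
  calc P * (C * q ^ 4) = (P * C * q ^ 2) * q ^ 2 := by ring
    _ ≤ (P * C * q ^ 2) * (9 * N ^ 2) := mul_le_mul_of_nonneg_left h4 (by positivity)
    _ = _ := by ring

/-- Crude size count, n⁸ terms of size at most 16n⁸, useful only when n is bounded. -/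
lemma mem_kiteExponents_of_le_one {V : Type*} [Fintype V] {e : V → V → ℝ} {n : ℝ}
    (h : SparseKernel e n) {a : Fin 4 → ℝ} (ha : ∀ j, a j ≤ 1) :
    a ∈ kiteExponents e n (16 * n ^ 12) := by
  intro F hF1 hF
  have hn := h.one_le
  have h0 : ∀ j x, 0 ≤ F j x := fun j x => zero_le_one.trans (hF1 j x)
  have h1 : ∀ j x, F j x ^ a j ≤ 2 * n ^ 2 := fun j x => by
    calc F j x ^ a j ≤ F j x ^ (1 : ℝ) := Real.rpow_le_rpow_of_exponent_le (hF1 j x) (ha j)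
      _ = F j x := Real.rpow_one _
      _ ≤ ∑ y, F j y := Finset.single_le_sum (fun y _ => h0 j y) (Finset.mem_univ x)
      _ ≤ _ := hF j
  have h2 : ∀ j x, 0 ≤ F j x ^ a j := fun j x => Real.rpow_nonneg (h0 j x) _
  refine (h.kiteSum_mono (h2 0) (h2 1) (h2 2) (h2 3) (h1 0) (h1 1) (h1 2) (h1 3)).trans ?_
  have hpt : ∀ x y z w, e x y * e y z * e z w * e z x *
      (2 * n ^ 2 * (2 * n ^ 2) * (2 * n ^ 2) * (2 * n ^ 2)) ≤ 16 * n ^ 8 := by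
    intro x y z w
    have : e x y * e y z * e z w * e z x ≤ 1 :=
      mul_le_one₀ (mul_le_one₀ (mul_le_one₀ (h.le_one _ _) (h.nonneg _ _) (h.le_one _ _))
        (h.nonneg _ _) (h.le_one _ _)) (h.nonneg _ _) (h.le_one _ _)
    calc _ ≤ 1 * (2 * n ^ 2 * (2 * n ^ 2) * (2 * n ^ 2) * (2 * n ^ 2)) :=
          mul_le_mul_of_nonneg_right this (by positivity)
      _ = _ := by ring
  refine (Finset.sum_le_sum fun x _ => Finset.sum_le_sum fun y _ =>
    Finset.sum_le_sum fun z _ => Finset.sum_le_sum fun w _ => hpt x y z w).trans (le_of_eq ?_)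
  simp only [Finset.sum_const, nsmul_eq_mul, Finset.card_univ, h.card]
  ring

/-! ### Testing the diamond form: necessary conditions. -/

/-- If every point `s` of the circle gives rise to a diamond with vertices in the sets `E j`, then
the diamond form of these sets is at least `q⁻²`. -/
lemma le_diamondForm (hodd : Odd (Fintype.card F)) (ht : t ≠ 0) (E : Fin 4 → Set (Plane F))
    (c : Plane F → Plane F × Plane F × Plane F × Plane F) (hc : Function.Injective c)
    (h₁ : ∀ s ∈ circle t, (c s).1 ∈ E 0) (h₂ : ∀ s ∈ circle t, (c s).2.1 ∈ E 1)
    (h₃ : ∀ s ∈ circle t, (c s).2.2.1 ∈ E 2) (h₄ : ∀ s ∈ circle t, (c s).2.2.2 ∈ E 3)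
    (h₁₂ : ∀ s ∈ circle t, (c s).1 - (c s).2.1 ∈ circle t)
    (h₂₃ : ∀ s ∈ circle t, (c s).2.1 - (c s).2.2.1 ∈ circle t)
    (h₃₄ : ∀ s ∈ circle t, (c s).2.2.1 - (c s).2.2.2 ∈ circle t)
    (h₄₁ : ∀ s ∈ circle t, (c s).2.2.2 - (c s).1 ∈ circle t)
    (h₁₃ : ∀ s ∈ circle t, (c s).1 - (c s).2.2.1 ∈ circle t) :
    ((Fintype.card F : ℝ) ^ 2)⁻¹ ≤ diamondForm t (fun j => (E j).indicator 1) := by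
  classical
  let φ : Plane F × Plane F × Plane F × Plane F → ℝ := fun v =>
    circleInd t (v.1 - v.2.1) * circleInd t (v.2.1 - v.2.2.1) *
      circleInd t (v.2.2.1 - v.2.2.2) * circleInd t (v.2.2.2 - v.1) *
      circleInd t (v.1 - v.2.2.1) * ((E 0).indicator 1 v.1 * (E 1).indicator 1 v.2.1 *
        (E 2).indicator 1 v.2.2.1 * (E 3).indicator 1 v.2.2.2)
  have hφ0 : ∀ v, 0 ≤ φ v := by
    intro v
    have hE : ∀ j x, (0 : ℝ) ≤ (E j).indicator 1 x := fun j x =>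
      Set.indicator_nonneg (fun _ _ => zero_le_one) x
    exact mul_nonneg (mul_nonneg (mul_nonneg (mul_nonneg (mul_nonneg (circleInd_nonneg _ _)
      (circleInd_nonneg _ _)) (circleInd_nonneg _ _)) (circleInd_nonneg _ _))
      (circleInd_nonneg _ _)) (mul_nonneg (mul_nonneg (mul_nonneg (hE _ _) (hE _ _)) (hE _ _))
      (hE _ _))
  have hφ1 : ∀ s, circleInd t s ≤ φ (c s) := by
    intro s
    by_cases hs : s ∈ circle t
    · rw [circleInd_of_mem hs]
      simp only [φ, circleInd_of_mem (h₁₂ s hs), circleInd_of_mem (h₂₃ s hs),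
        circleInd_of_mem (h₃₄ s hs), circleInd_of_mem (h₄₁ s hs), circleInd_of_mem (h₁₃ s hs),
        Set.indicator_of_mem (h₁ s hs), Set.indicator_of_mem (h₂ s hs),
        Set.indicator_of_mem (h₃ s hs), Set.indicator_of_mem (h₄ s hs), Pi.one_apply, mul_one,
        le_refl]
    · rw [circleInd_of_notMem hs]
      exact hφ0 _
  -- Injectivity of `c` yields |S_t| distinct diamonds; the normalization q²|S_t| then leaves q⁻².
  have hsum : ((circle t).ncard : ℝ) ≤ ∑ v, φ v := by
    rw [← sum_circleInd]
    calc _ ≤ ∑ s, φ (c s) := Finset.sum_le_sum fun s _ => hφ1 s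
      _ = ∑ v ∈ Finset.univ.image c, φ v := (Finset.sum_image fun _ _ _ _ h => hc h).symm
      _ ≤ _ := Finset.sum_le_sum_of_subset_of_nonneg (Finset.subset_univ _) fun v _ _ => hφ0 v
  have hform : diamondForm t (fun j => (E j).indicator 1) =
      1 / ((Fintype.card F : ℝ) ^ 2 * ((circle t).ncard : ℝ)) * ∑ v, φ v := by
    simp only [diamondForm, φ, Fintype.sum_prod_type]
  have hq : (0 : ℝ) < Fintype.card F := by exact_mod_cast Fintype.card_pos
  have hN3 : (Fintype.card F : ℝ) ≤ 3 * (circle t).ncard := by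
    exact_mod_cast card_le_three_mul_ncard_circle hodd ht
  have hNpos : (0 : ℝ) < (circle t).ncard := by linarith
  rw [hform]
  calc _ = 1 / ((Fintype.card F : ℝ) ^ 2 * ((circle t).ncard : ℝ)) * (circle t).ncard := by
        field_simp
    _ ≤ _ := mul_le_mul_of_nonneg_left hsum (by positivity)

/-- Here κ is the codimension of the set; 2^(1/p) ≤ 2 makes the constant independent of p. -/
lemma normL_indicator_le {p : ℝ≥0∞} (hp : 1 ≤ p) {E : Set (Plane F)} {κ : ℝ}
    (hE : (E.ncard : ℝ) ≤ 2 * (Fintype.card F : ℝ) ^ 2 * (Fintype.card F : ℝ) ^ (-κ)) :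
    normL p (E.indicator 1) ≤ 2 * (Fintype.card F : ℝ) ^ (-(κ * (p⁻¹).toReal)) := by
  classical
  have hq : (0 : ℝ) < Fintype.card F := by exact_mod_cast Fintype.card_pos
  have habs : ∀ x, |E.indicator (1 : Plane F → ℝ) x| = E.indicator 1 x := fun x =>
    abs_of_nonneg (Set.indicator_nonneg (fun _ _ => zero_le_one) x)
  by_cases hp' : p = ∞
  · rw [normL, if_pos hp', hp']
    simp only [ENNReal.inv_top, ENNReal.toReal_zero, mul_zero, neg_zero, Real.rpow_zero, mul_one,
      habs]
    exact (ciSup_le fun x => Set.indicator_le_self' (fun _ _ => zero_le_one) x).trans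
      (by norm_num : (1 : ℝ) ≤ 2)
  · have hr : 1 ≤ p.toReal := by simpa using ENNReal.toReal_mono hp' hp
    have hr0 : 0 < p.toReal := by linarith
    rw [normL, if_neg hp', ENNReal.toReal_inv]
    set r := p.toReal
    have hsum : ∑ x, |E.indicator (1 : Plane F → ℝ) x| ^ r = E.ncard := by
      rw [Set.ncard_eq_toFinset_card']
      have : ∀ x, |E.indicator (1 : Plane F → ℝ) x| ^ r = if x ∈ E then 1 else 0 := by
        intro x
        rw [habs]
        by_cases hx : x ∈ E
        · simp [hx]
        · simp [hx, Real.zero_rpow hr0.ne']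
      simp only [this, Finset.sum_boole]
      congr 2
      ext x
      simp
    rw [hsum, one_div]
    have h1 : ((Fintype.card F : ℝ) ^ 2)⁻¹ * E.ncard ≤ 2 * (Fintype.card F : ℝ) ^ (-κ) := by
      rw [inv_mul_le_iff₀ (by positivity)]
      linarith
    calc _ ≤ (2 * (Fintype.card F : ℝ) ^ (-κ)) ^ r⁻¹ :=
          Real.rpow_le_rpow (by positivity) h1 (inv_nonneg.2 hr0.le)
      _ = 2 ^ r⁻¹ * (Fintype.card F : ℝ) ^ (-(κ * r⁻¹)) := by
          rw [Real.mul_rpow (by norm_num) (by positivity), ← Real.rpow_mul hq.le, neg_mul]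
      _ ≤ _ := by
          refine mul_le_mul_of_nonneg_right ?_ (by positivity)
          calc (2 : ℝ) ^ r⁻¹ ≤ 2 ^ (1 : ℝ) :=
                Real.rpow_le_rpow_of_exponent_le one_le_two (inv_le_one_of_one_le₀ hr)
            _ = 2 := Real.rpow_one 2

lemma ncard_singleton_le_rpow :
    ((({0} : Set (Plane F)).ncard : ℕ) : ℝ) ≤
      2 * (Fintype.card F : ℝ) ^ 2 * (Fintype.card F : ℝ) ^ (-(2 : ℝ)) := by
  have hq : (0 : ℝ) < Fintype.card F := by exact_mod_cast Fintype.card_pos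
  rw [Real.rpow_neg hq.le, Real.rpow_two, mul_assoc, mul_inv_cancel₀ (by positivity)]
  simp

lemma ncard_circle_le_rpow (t : F) : ((circle t).ncard : ℝ) ≤
    2 * (Fintype.card F : ℝ) ^ 2 * (Fintype.card F : ℝ) ^ (-(1 : ℝ)) := by
  have hq : (0 : ℝ) < Fintype.card F := by exact_mod_cast Fintype.card_pos
  have : 2 * (Fintype.card F : ℝ) ^ 2 * (Fintype.card F : ℝ) ^ (-(1 : ℝ)) =
      2 * Fintype.card F := by
    rw [Real.rpow_neg hq.le, Real.rpow_one]; field_simp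
  rw [this]
  exact_mod_cast ncard_circle_le t

/-- Testing the diamond form on sets of size about `q ^ (2 - κ j)`. -/
lemma rpow_le_of_strongBound {p : Fin 4 → ℝ≥0∞}
    (hp : ∀ j, 1 ≤ p j) {C : ℝ≥0} (hC : StrongBound (diamondForm t) p C)
    (E : Fin 4 → Set (Plane F)) (κ : Fin 4 → ℝ)
    (hE : ∀ j, ((E j).ncard : ℝ) ≤
      2 * (Fintype.card F : ℝ) ^ 2 * (Fintype.card F : ℝ) ^ (-κ j))
    (hlow : ((Fintype.card F : ℝ) ^ 2)⁻¹ ≤ diamondForm t (fun j => (E j).indicator 1)) :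
    (Fintype.card F : ℝ) ^ (∑ j, κ j * ((p j)⁻¹).toReal - 2) ≤ 16 * C := by
  have hq : (0 : ℝ) < Fintype.card F := by exact_mod_cast Fintype.card_pos
  have h1 := hlow.trans (hC (fun j => (E j).indicator 1) fun j x =>
    Set.indicator_nonneg (fun _ _ => zero_le_one) x)
  have h2 : ∏ j, normL (p j) ((E j).indicator 1) ≤
      ∏ j, 2 * (Fintype.card F : ℝ) ^ (-(κ j * ((p j)⁻¹).toReal)) :=
    Finset.prod_le_prod (fun j _ => normL_nonneg _ _) fun j _ => normL_indicator_le (hp j) (hE j)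
  rw [Finset.prod_mul_distrib, ← Real.rpow_sum_of_pos hq, Finset.sum_neg_distrib] at h2
  have h3 := h1.trans (mul_le_mul_of_nonneg_left h2 C.coe_nonneg)
  rw [Real.rpow_neg hq.le] at h3
  rw [Real.rpow_sub hq, Real.rpow_two]
  set β := ∑ j, κ j * ((p j)⁻¹).toReal
  have hβ : 0 < (Fintype.card F : ℝ) ^ β := Real.rpow_pos_of_pos hq _
  have h4 := mul_le_mul_of_nonneg_left h3 hβ.le
  calc _ = (Fintype.card F : ℝ) ^ β * ((Fintype.card F : ℝ) ^ 2)⁻¹ := div_eq_mul_inv _ _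
    _ ≤ _ := h4
    _ = _ := by
      simp only [Finset.prod_const, Finset.card_univ, Fintype.card_fin]
      field_simp
      norm_num

/-- The three necessary conditions for the boundedness of the diamond form. -/
lemma necessary_conditions (hodd : Odd (Fintype.card F)) (h3 : IsSquare (3 : F)) (ht : t ≠ 0)
    {p : Fin 4 → ℝ≥0∞} (hp : ∀ j, 1 ≤ p j) {C : ℝ≥0} (hC : StrongBound (diamondForm t) p C)
    {a : Fin 4 → ℝ} (ha : ∀ j, a j = ((p j)⁻¹).toReal) :
    (Fintype.card F : ℝ) ^ (2 * a 0 + a 1 + a 2 + a 3 - 2) ≤ 16 * C ∧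
      (Fintype.card F : ℝ) ^ (a 0 + a 1 + 2 * a 2 + a 3 - 2) ≤ 16 * C ∧
      (Fintype.card F : ℝ) ^ (a 0 + 2 * a 1 + a 2 + 2 * a 3 - 2) ≤ 16 * C := by
  have h2 := two_ne_zero_of_odd_card hodd
  have hex : ∀ s : Plane F, ∃ x, s ∈ circle t → x ∈ circle t ∧ s - x ∈ circle t := by
    intro s
    by_cases hs : s ∈ circle t
    · obtain ⟨x, hx⟩ := exists_mem_circle_sub_mem h2 h3 hs
      exact ⟨x, fun _ => hx⟩
    · exact ⟨0, fun h => absurd h hs⟩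
  choose c hc using hex
  have hc1 := fun s hs => (hc s hs).1
  have hc2 := fun s hs => (hc s hs).2
  have hc3 : ∀ s, s ∈ circle t → c s - s ∈ circle t := fun s hs => by
    rw [← neg_sub]; exact neg_mem_circle (hc2 s hs)
  refine ⟨?_, ?_, ?_⟩
  -- All three tests use degenerate diamonds with x² = x⁴, that is, one equilateral triangle with a
  -- vertex at 0. Here 0 is x¹; in the second test it is x³, and in the third it is x² = x⁴.
  · have := rpow_le_of_strongBound hp hC ![{0}, circle t, circle t, circle t] ![2, 1, 1, 1]
      (by
        intro j
        fin_cases j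
        exacts [ncard_singleton_le_rpow, ncard_circle_le_rpow t, ncard_circle_le_rpow t,
          ncard_circle_le_rpow t])
      (le_diamondForm hodd ht _ (fun s => (0, c s, s, c s)) (fun x y h => by simp_all)
        (fun s hs => by simp) hc1 (fun s hs => hs) hc1
        (fun s hs => by simpa using neg_mem_circle (hc1 s hs)) hc3 hc2
        (fun s hs => by simpa using hc1 s hs) (fun s hs => by simpa using neg_mem_circle hs))
    simpa [Fin.sum_univ_four, ← ha] using this
  · have := rpow_le_of_strongBound hp hC ![circle t, circle t, {0}, circle t] ![1, 1, 2, 1]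
      (by
        intro j
        fin_cases j
        exacts [ncard_circle_le_rpow t, ncard_circle_le_rpow t, ncard_singleton_le_rpow,
          ncard_circle_le_rpow t])
      (le_diamondForm hodd ht _ (fun s => (s, c s, 0, c s)) (fun x y h => by simp_all)
        (fun s hs => hs) hc1 (fun s hs => by simp) hc1 hc2
        (fun s hs => by simpa using hc1 s hs) (fun s hs => by simpa using neg_mem_circle (hc1 s hs))
        hc3 (fun s hs => by simpa using hs))
    simpa [Fin.sum_univ_four, ← ha] using this
  · have := rpow_le_of_strongBound hp hC ![circle t, {0}, circle t, {0}] ![1, 2, 1, 2]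
      (by
        intro j
        fin_cases j
        exacts [ncard_circle_le_rpow t, ncard_singleton_le_rpow, ncard_circle_le_rpow t,
          ncard_singleton_le_rpow])
      (le_diamondForm hodd ht _ (fun s => (s, 0, c s, 0)) (fun x y h => by simp_all)
        (fun s hs => hs) (fun s hs => by simp) hc1 (fun s hs => by simp)
        (fun s hs => by simpa using hs) (fun s hs => by simpa using neg_mem_circle (hc1 s hs))
        (fun s hs => by simpa using hc1 s hs) (fun s hs => by simpa using neg_mem_circle hs) hc2)
    simpa [Fin.sum_univ_four, ← ha] using this

end

/-! ### Bounded fields and the final assembly. -/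

lemma le_rpow_inv_of_rpow_le {q β A : ℝ} (hq : 0 ≤ q) (hβ : 0 < β) (h : q ^ β ≤ A) :
    q ≤ A ^ β⁻¹ := by
  calc q = (q ^ β) ^ β⁻¹ := (Real.rpow_rpow_inv hq hβ.ne').symm
    _ ≤ _ := Real.rpow_le_rpow (Real.rpow_nonneg hq _) h (inv_nonneg.2 hβ.le)

lemma kiteExponents_mono {V : Type*} [Fintype V] {e : V → V → ℝ} {n C D : ℝ} (hCD : C ≤ D) :
    kiteExponents e n C ⊆ kiteExponents e n D := fun _ ha F hF1 hF =>
  (ha F hF1 hF).trans (mul_le_mul_of_nonneg_right hCD (by positivity))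

lemma lesssimOne_of_strongBound {ι : Type*} {F : ι → Type*} [∀ i, Fintype (F i)]
    {Λ : ∀ i, (Fin 4 → Plane (F i) → ℝ) → ℝ} {p : Fin 4 → ℝ≥0∞} {C : ℝ≥0}
    (h : ∀ i, StrongBound (Λ i) p C) (hC : 1 ≤ C) :
    LesssimOne (fun i => bestConst (Λ i) p) :=
  ⟨C, hC, fun i => (bestConst_le_iff _ _ _).2 (h i)⟩

/-- If the kernels of a family live on sets of bounded size, then the kite is bounded. -/
lemma lesssimOne_kiteForm_of_card_le {ι : Type*} (F : ι → Type*) [∀ i, Field (F i)]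
    [∀ i, Fintype (F i)] (t : ∀ i, F i) (hodd : ∀ i, Odd (Fintype.card (F i)))
    (ht : ∀ i, t i ≠ 0) {p : Fin 4 → ℝ≥0∞} (hp : ∀ j, 1 ≤ p j) {Q : ℝ}
    (hQ : ∀ i, (Fintype.card (F i) : ℝ) ≤ Q) :
    LesssimOne (fun i => bestConst (kiteForm (t i)) p) := by
  -- The power is even, so no sign of Q is needed, as for an empty family. Adding 1 to C below makes
  -- the final constant at least 1.
  let C : ℝ≥0 := ⟨16 * Q ^ 12, by positivity⟩
  have hC : ∀ i, StrongBound (kiteForm (t i)) p (9 * (C + 1)) := by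
    intro i
    have h := sparseKernel_circleInd (hodd i) (ht i)
    refine strongBound_of_mem_kiteExponents (hodd i) (ht i) hp
      (kiteExponents_mono ?_ (mem_kiteExponents_of_le_one h fun j => ?_))
    · have h1 : (Fintype.card (F i) : ℝ) ^ 12 ≤ Q ^ 12 :=
        pow_le_pow_left₀ (Nat.cast_nonneg _) (hQ i) 12
      have h2 : ((C + 1 : ℝ≥0) : ℝ) = 16 * Q ^ 12 + 1 := rfl
      rw [h2]
      linarith
    · exact ENNReal.toReal_le_of_le_ofReal zero_le_one (by simpa using hp j)
  refine lesssimOne_of_strongBound hC ?_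
  calc (1 : ℝ≥0) ≤ 9 * 1 := by norm_num
    _ ≤ 9 * (C + 1) := by gcongr; exact le_add_self

/-- The kite form is of strong type for all exponents in the polytope. -/
lemma strongBound_kiteForm {F : Type*} [Field F] [Fintype F] {t : F}
    (hodd : Odd (Fintype.card F)) (ht : t ≠ 0) {p : Fin 4 → ℝ≥0∞} (hp : ∀ j, 1 ≤ p j)
    {a : Fin 4 → ℝ} (ha : ∀ j, a j = ((p j)⁻¹).toReal)
    (h₁ : 2 * a 0 + a 1 + a 2 + a 3 ≤ 2) (h₂ : a 0 + a 1 + 2 * a 2 + a 3 ≤ 2)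
    (h₃ : a 0 + 2 * a 1 + a 2 + 2 * a 3 ≤ 2) : StrongBound (kiteForm t) p (9 * 424) := by
  refine strongBound_of_mem_kiteExponents hodd ht hp ?_
  rw [← funext ha]
  have := (sparseKernel_circleInd hodd ht).mem_kiteExponents
    (fun j => (ha j).symm ▸ ENNReal.toReal_nonneg) h₁ h₂ h₃
  exact_mod_cast this

end GraphForms

end

theorem theorem9p10 {ι : Type*} (F : ι → Type*) [∀ i, Field (F i)] [∀ i, Fintype (F i)]
    (t : ∀ i, F i) (hodd : ∀ i, Odd (Fintype.card (F i)))
    (h3 : ∀ i, IsSquare (3 : F i)) (ht : ∀ i, t i ≠ 0) :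
    (∀ p : Fin 4 → ℝ≥0∞, (∀ j, 1 ≤ p j) →
      GraphForms.LesssimOne (fun i => GraphForms.bestConst (GraphForms.diamondForm (t i)) p) →
      p ≠ ![2, 2, 2, ∞] →
      GraphForms.LesssimOne (fun i => GraphForms.bestConst (GraphForms.kiteForm (t i)) p)) ∧
    (∃ C : ℝ≥0, ∀ i,
      GraphForms.RestrictedBound (GraphForms.kiteForm (t i)) ![2, 2, 2, ∞] C) := by
  refine ⟨fun p hp hd _ => ?_, 9 * 424, fun i E => ?_⟩
  · obtain ⟨C, -, hC⟩ := hd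
    let a : Fin 4 → ℝ := fun j => ((p j)⁻¹).toReal
    have hnec := fun i => GraphForms.necessary_conditions (a := a) (hodd i) (h3 i) (ht i) hp
      ((GraphForms.bestConst_le_iff _ _ _).1 (hC i)) fun _ => rfl
    -- A violated inequality bounds q by (16C)^(1/β), and β depends only on p.
    have hbdd : ∀ β : ℝ, 0 < β → (∀ i, (Fintype.card (F i) : ℝ) ^ β ≤ 16 * C) →
        GraphForms.LesssimOne (fun i => GraphForms.bestConst (GraphForms.kiteForm (t i)) p) :=
      fun β hβ h => GraphForms.lesssimOne_kiteForm_of_card_le F t hodd ht hp fun i =>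
        GraphForms.le_rpow_inv_of_rpow_le (Nat.cast_nonneg _) hβ (h i)
    rcases lt_or_ge 2 (2 * a 0 + a 1 + a 2 + a 3) with h₁ | h₁
    · exact hbdd _ (sub_pos.2 h₁) fun i => (hnec i).1
    rcases lt_or_ge 2 (a 0 + a 1 + 2 * a 2 + a 3) with h₂ | h₂
    · exact hbdd _ (sub_pos.2 h₂) fun i => (hnec i).2.1
    rcases lt_or_ge 2 (a 0 + 2 * a 1 + a 2 + 2 * a 3) with h₃ | h₃
    · exact hbdd _ (sub_pos.2 h₃) fun i => (hnec i).2.2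
    exact GraphForms.lesssimOne_of_strongBound
      (fun i => GraphForms.strongBound_kiteForm (hodd i) (ht i) hp (fun _ => rfl) h₁ h₂ h₃)
      (by norm_num)
  -- All three inequalities are equalities at this vertex, so the strong bound applies, in
  -- particular to indicators.
  · refine GraphForms.strongBound_kiteForm (a := ![1 / 2, 1 / 2, 1 / 2, 0]) (hodd i) (ht i)
      ?_ ?_ ?_ ?_ ?_ _ fun j x => Set.indicator_nonneg (fun _ _ => zero_le_one) x
    · intro j; fin_cases j <;> simp
    · intro j; fin_cases j <;> simp
    all_goals simp only [Matrix.cons_val]; norm_num
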